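/- Let $M$ be a complex manifold with a (nonsingular) holomorphic foliation $\mathcal F$ of complex codimension $n$, with tangent bundle $T\mathcal F\subset TM$. Let $G$ be a connected complex Lie group with Lie algebra $\mathfrak g$ and $H\subset G$ a complex Lie subgroup, and let $\pi:E_H\to M$ be a holomorphic principal $H$-bundle. Put $\mathrm{At}(E_H)=(TE_H)/H$ and $\mathrm{ad}(E_H)=\ker(d\pi)/H\subset \mathrm{At}(E_H)$, so that there is the Atiyah exact sequence $0\to \mathrm{ad}(E_H)\to \mathrm{At}(E_H)\to TM\to 0$; let $E_G=E_H\times^H G$ be the principal $G$-bundle obtained by extension of the structure group, with $\mathrm{At}(E_G)$, $\mathrm{ad}(E_G)$ defined in the same way. The inclusion $E_H\to E_G$ induces homomorphisms $i:\mathrm{At}(E_H)\to\mathrm{At}(E_G)$ and $\iota:\mathrm{ad}(E_H)\to \mathrm{ad}(E_G)$. A partial holomorphic connection on $E_H$ along $\mathcal F$ is a holomorphic homomorphism $\lambda:T\mathcal F\to \mathrm{At}(E_H)$ lifting the inclusion $T\mathcal F\subset TM$. It is flat if its curvature $p([\lambda X,\lambda Y])$ ($X,Y$ local holomorphic sections of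 $T\mathcal F$, $p$ the projection to $\mathrm{ad}(E_H)$ with kernel $\lambda(T\mathcal F)$) vanishes. A holomorphic connection is a holomorphic splitting $D:TM\to\mathrm{At}$ of the Atiyah sequence, or equivalently the corresponding projection $\varphi:\mathrm{At}\to\mathrm{ad}$. A transverse generalized holomorphic Cartan geometry with model $(G,H)$ on $(M,\mathcal F)$ is a triple $((E_H,\lambda),\beta)$, where $\lambda$ is a flat partial connection on $E_H$ along $\mathcal F$ and $\beta:\mathrm{At}(E_H)/\lambda(T\mathcal F)\to\mathrm{ad}(E_G)$ is a holomorphic homomorphism which restricts to $\iota$ on $\mathrm{ad}(E_H)$ and which preserves the partial connections along $\mathcal F$, namely $\nabla_X[s]=[[\lambda X,s]]$ on $\mathrm{At}(E_H)/\lambda(T\mathcal F)$ and $\nabla_Xw=[i(\lambda X),w]$ on $\mathrm{ad}(E_G)$. Let $((E_H,\lambda),\beta)$ be a transverse generalized holomorphic Cartan geometry with model $(G,H)$ on $(M,\mathcal F)$. Then $(w,v)\mapsto w+i(v)$ is a surjection $\mathrm{ad}(E_G)\oplus\mathrm{At}(E_H)\to\mathrm{At}(E_G)$ with kernel $\{(\iota(u),-u):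 u\in\mathrm{ad}(E_H)\}$, so that $\mathrm{At}(E_G)=(\mathrm{ad}(E_G)\oplus\mathrm{At}(E_H))/\mathrm{ad}(E_H)$, and there is a unique holomorphic connection on the principal $G$-bundle $E_G$ whose projection $\varphi:\mathrm{At}(E_G)\to\mathrm{ad}(E_G)$ satisfies $$\varphi(w+i(v))=w+\beta([v])\qquad (w\in\mathrm{ad}(E_G),\ v\in\mathrm{At}(E_H)).$$ This connection is flat in the direction of $\mathcal F$: its restriction to $T\mathcal F$ is a flat partial connection, and moreover the contraction of its curvature with any vector of $T\mathcal F$ vanishes. -/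

import Mathlib

open scoped Manifold ContDiff Topology
open Set VectorField

noncomputable section

namespace TransverseCartanGeometry

section Basic

variable {E H : Type*} [NormedAddCommGroup E] [NormedSpace ℂ E] [TopologicalSpace H]
  (I : ModelWithCorners ℂ E H) {N : Type*} [TopologicalSpace N] [ChartedSpace H N]

/-- Transport of tangent vectors along an equality of base points. -/
def tcast {x y : N} (h : x = y) : TangentSpace I x →ₗ[ℂ] TangentSpace I y := by
  subst h; exact LinearMap.id

@[simp] theorem tcast_rfl {x : N} (h : x = x) (v : TangentSpace I x) : tcast I h v = v := rfl

/-- A vector field is holomorphic on the set `U`. -/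
def IsHolField [IsManifold I 1 N] (U : Set N) (X : ∀ x : N, TangentSpace I x) : Prop :=
  ContMDiffOn I I.tangent ω (fun x => (⟨x, X x⟩ : TangentBundle I N)) U

end Basic

variable {EP HP : Type*} [NormedAddCommGroup EP] [NormedSpace ℂ EP] [TopologicalSpace HP]
  {IP : ModelWithCorners ℂ EP HP}
  {EM EG : Type*} [NormedAddCommGroup EM] [NormedSpace ℂ EM]
  [NormedAddCommGroup EG] [NormedSpace ℂ EG]
  {P M G : Type*} [TopologicalSpace P] [ChartedSpace HP P]
  [TopologicalSpace M] [ChartedSpace EM M]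
  [TopologicalSpace G] [ChartedSpace EG G] [Group G]

/-- `e` is an equivariant biholomorphism of the part of `P` over the open set `U` with `U × G`. -/
structure IsPrincipalChart (IP : ModelWithCorners ℂ EP HP) (EM EG : Type*)
    [NormedAddCommGroup EM] [NormedSpace ℂ EM] [NormedAddCommGroup EG] [NormedSpace ℂ EG]
    [ChartedSpace EM M] [ChartedSpace EG G]
    (proj : P → M) (act : P → G → P) (U : Set M) (e : OpenPartialHomeomorph P (M × G)) : Prop where
  isOpen : IsOpen U
  source_eq : e.source = proj ⁻¹' U
  target_eq : e.target = U ×ˢ univ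
  fst_eq : ∀ p ∈ e.source, (e p).1 = proj p
  equivariant : ∀ p ∈ e.source, ∀ g, e (act p g) = ((e p).1, (e p).2 * g)
  contMDiffOn : ContMDiffOn IP (𝓘(ℂ, EM).prod 𝓘(ℂ, EG)) ω e e.source
  contMDiffOn_symm : ContMDiffOn (𝓘(ℂ, EM).prod 𝓘(ℂ, EG)) IP ω e.symm e.target

/-- A holomorphic (right) principal `G`-bundle over `M` with total space `P`. -/
structure PrincipalBundle (IP : ModelWithCorners ℂ EP HP) (EM EG : Type*)
    [NormedAddCommGroup EM] [NormedSpace ℂ EM] [NormedAddCommGroup EG] [NormedSpace ℂ EG]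
    (P M G : Type*) [TopologicalSpace P] [ChartedSpace HP P]
    [TopologicalSpace M] [ChartedSpace EM M] [TopologicalSpace G] [ChartedSpace EG G] [Group G]
    where
  proj : P → M
  act : P → G → P
  act_one : ∀ p, act p 1 = p
  act_mul : ∀ p g h, act p (g * h) = act (act p g) h
  proj_act : ∀ p g, proj (act p g) = proj p
  locallyTrivial : ∀ x : M, ∃ U : Set M, x ∈ U ∧
    ∃ e : OpenPartialHomeomorph P (M × G), IsPrincipalChart IP EM EG proj act U e

namespace PrincipalBundle

variable (B : PrincipalBundle IP EM EG P M G)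

def baseSet (x : M) : Set M := (B.locallyTrivial x).choose
theorem mem_baseSet (x : M) : x ∈ B.baseSet x := (B.locallyTrivial x).choose_spec.1
/-- A chosen local trivialization near `x`. -/
def triv (x : M) : OpenPartialHomeomorph P (M × G) := (B.locallyTrivial x).choose_spec.2.choose
theorem triv_spec (x : M) : IsPrincipalChart IP EM EG B.proj B.act (B.baseSet x) (B.triv x) :=
  (B.locallyTrivial x).choose_spec.2.choose_spec

theorem mem_triv_source (x : M) {p : P} : p ∈ (B.triv x).source ↔ B.proj p ∈ B.baseSet x := by
  rw [(B.triv_spec x).source_eq]; rfl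

theorem mem_triv_target (x : M) {z : M × G} : z ∈ (B.triv x).target ↔ z.1 ∈ B.baseSet x := by
  rw [(B.triv_spec x).target_eq]; simp

theorem proj_triv_symm (x : M) {z : M × G} (hz : z.1 ∈ B.baseSet x) :
    B.proj ((B.triv x).symm z) = z.1 := by
  have hz' := (B.mem_triv_target x).2 hz
  rw [← (B.triv_spec x).fst_eq _ ((B.triv x).map_target hz'), (B.triv x).right_inv hz']

theorem triv_eta (x : M) {p : P} (hp : B.proj p ∈ B.baseSet x) :
    B.triv x p = (B.proj p, (B.triv x p).2) := by
  rw [← (B.triv_spec x).fst_eq p ((B.mem_triv_source x).2 hp)]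

theorem triv_act (x : M) {p : P} (hp : B.proj p ∈ B.baseSet x) (g : G) :
    B.triv x (B.act p g) = (B.proj p, (B.triv x p).2 * g) := by
  have hp' := (B.mem_triv_source x).2 hp
  rw [(B.triv_spec x).equivariant p hp' g, (B.triv_spec x).fst_eq p hp']

theorem act_eq (x : M) {p : P} (hp : B.proj p ∈ B.baseSet x) (g : G) :
    B.act p g = (B.triv x).symm (B.proj p, (B.triv x p).2 * g) := by
  rw [← B.triv_act x hp, (B.triv x).left_inv]
  rw [B.mem_triv_source, B.proj_act]; exact hp

theorem act_symm (x : M) {z : M × G} (hz : z.1 ∈ B.baseSet x) (g : G) :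
    B.act ((B.triv x).symm z) g = (B.triv x).symm (z.1, z.2 * g) := by
  have hp : B.proj ((B.triv x).symm z) ∈ B.baseSet x := by rwa [B.proj_triv_symm x hz]
  rw [B.act_eq x hp, (B.triv x).right_inv ((B.mem_triv_target x).2 hz), B.proj_triv_symm x hz]

theorem fiber_nonempty (x : M) : Nonempty {p : P // B.proj p = x} :=
  ⟨⟨(B.triv x).symm (x, 1), B.proj_triv_symm x (B.mem_baseSet x)⟩⟩

theorem contMDiff_proj : ContMDiff IP 𝓘(ℂ, EM) ω B.proj := by
  intro p
  have hp := (B.mem_triv_source (B.proj p)).2 (B.mem_baseSet (B.proj p))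
  have h1 := ((B.triv_spec (B.proj p)).contMDiffOn.contMDiffAt
    ((B.triv (B.proj p)).open_source.mem_nhds hp))
  refine (contMDiffAt_fst.comp p h1).congr_of_eventuallyEq ?_
  filter_upwards [(B.triv (B.proj p)).open_source.mem_nhds hp] with q hq
  exact ((B.triv_spec (B.proj p)).fst_eq q hq).symm

theorem contMDiff_act [LieGroup 𝓘(ℂ, EG) ω G] :
    ContMDiff (IP.prod 𝓘(ℂ, EG)) IP ω (fun z : P × G => B.act z.1 z.2) := by
  rintro ⟨p, g⟩
  set x := B.proj p
  have hp := (B.mem_triv_source x).2 (B.mem_baseSet x)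
  have h1 := ((B.triv_spec x).contMDiffOn.contMDiffAt ((B.triv x).open_source.mem_nhds hp))
  have h1' : ContMDiffAt (IP.prod 𝓘(ℂ, EG)) (𝓘(ℂ, EM).prod 𝓘(ℂ, EG)) ω
      (fun z : P × G => B.triv x z.1) (p, g) := h1.comp (p, g) contMDiffAt_fst
  have h2 : ContMDiffAt (IP.prod 𝓘(ℂ, EG)) (𝓘(ℂ, EM).prod 𝓘(ℂ, EG)) ω
      (fun z : P × G => (B.proj z.1, (B.triv x z.1).2 * z.2)) (p, g) := by
    refine ContMDiffAt.prodMk ((B.contMDiff_proj p).comp (p, g) contMDiffAt_fst) ?_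
    exact (contMDiffAt_snd.comp (p, g) h1').mul contMDiffAt_snd
  have ht : (B.proj p, (B.triv x p).2 * g) ∈ (B.triv x).target :=
    (B.mem_triv_target x).2 (B.mem_baseSet x)
  have h3 := ((B.triv_spec x).contMDiffOn_symm.contMDiffAt ((B.triv x).open_target.mem_nhds ht))
  refine (ContMDiffAt.comp (p, g) h3 h2).congr_of_eventuallyEq ?_
  have : ∀ᶠ z : P × G in 𝓝 (p, g), z.1 ∈ (B.triv x).source :=
    continuousAt_fst.eventually ((B.triv x).open_source.mem_nhds hp)
  filter_upwards [this] with z hz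
  exact B.act_eq x ((B.mem_triv_source x).1 hz) z.2

theorem contMDiff_act_right [LieGroup 𝓘(ℂ, EG) ω G] (g : G) :
    ContMDiff IP IP ω (fun p : P => B.act p g) :=
  B.contMDiff_act.comp (contMDiff_id.prodMk contMDiff_const)

theorem mfderiv_act_bijective [LieGroup 𝓘(ℂ, EG) ω G] (g : G) (p : P) :
    (mfderiv IP IP (fun p : P => B.act p g) p).IsInvertible := by
  have := (B.contMDiff_act_right g)
  let d : P ≃ₘ^ω⟮IP, IP⟯ P :=
    { toFun := fun p => B.act p g
      invFun := fun p => B.act p g⁻¹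
      left_inv := fun p => by simp [← B.act_mul, B.act_one]
      right_inv := fun p => by simp [← B.act_mul, B.act_one]
      contMDiff_toFun := B.contMDiff_act_right g
      contMDiff_invFun := B.contMDiff_act_right g⁻¹ }
  exact ⟨d.mfderivToContinuousLinearEquiv (by simp) p, rfl⟩

/-- The fibre at `x` of the Atiyah bundle `(TP)/G`: a `G`-orbit of tangent vectors of `P` along the
fibre over `x` is the same thing as a `G`-invariant field of tangent vectors along this fibre. -/
def atiyah (x : M) : Submodule ℂ (∀ p : {p : P // B.proj p = x}, TangentSpace IP p.1) where
  carrier := {v | ∀ (p : {p : P // B.proj p = x}) (g : G),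
    v ⟨B.act p.1 g, (B.proj_act p.1 g).trans p.2⟩ =
      mfderiv IP IP (fun p' : P => B.act p' g) p.1 (v p)}
  add_mem' := fun {v w} hv hw p g => by
    simp only [Pi.add_apply, map_add]; rw [hv p g, hw p g]
  zero_mem' := fun p g => by simp
  smul_mem' := fun c v hv p g => by
    simp only [Pi.smul_apply, map_smul]; rw [hv p g]

/-- The `G`-invariant vector field on `P` given by a section of the Atiyah bundle. -/
def field (s : ∀ x, B.atiyah x) (p : P) : TangentSpace IP p := (s (B.proj p)).1 ⟨p, rfl⟩

theorem field_act (s : ∀ x, B.atiyah x) (p : P) (g : G) :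
    B.field s (B.act p g) = mfderiv IP IP (fun p' : P => B.act p' g) p (B.field s p) := by
  have key : ∀ (x : M) (h : B.proj (B.act p g) = x),
      B.field s (B.act p g) = (s x).1 ⟨B.act p g, h⟩ := by rintro x rfl; rfl
  rw [key _ (B.proj_act p g)]
  exact (s (B.proj p)).2 ⟨p, rfl⟩ g

/-- Holomorphic local sections of the Atiyah bundle over `U`: those given by holomorphic
`G`-invariant vector fields on the preimage of `U`. -/
def IsHolSection [IsManifold IP 1 P] (U : Set M) (s : ∀ x, B.atiyah x) : Prop :=
  IsHolField IP (B.proj ⁻¹' U) (B.field s)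

/-- The projection of the Atiyah bundle onto `TM` induced by the differential of `P → M`. -/
def anchor (x : M) : B.atiyah x →ₗ[ℂ] TangentSpace 𝓘(ℂ, EM) x :=
  tcast 𝓘(ℂ, EM) (B.fiber_nonempty x).some.2 ∘ₗ
    (mfderiv IP 𝓘(ℂ, EM) B.proj (B.fiber_nonempty x).some.1).toLinearMap ∘ₗ
    LinearMap.proj (B.fiber_nonempty x).some ∘ₗ (B.atiyah x).subtype

theorem exists_act (p q : P) (h : B.proj p = B.proj q) : ∃ g, B.act p g = q := by
  have hp := B.mem_baseSet (B.proj p)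
  have hq : B.proj q ∈ B.baseSet (B.proj p) := h ▸ hp
  refine ⟨((B.triv (B.proj p)) p).2⁻¹ * ((B.triv (B.proj p)) q).2, ?_⟩
  rw [B.act_eq _ hp, mul_inv_cancel_left, h, ← h]
  conv_lhs => rw [h, ← B.triv_eta _ (h ▸ hq)]
  rw [← h, OpenPartialHomeomorph.left_inv _ ((B.mem_triv_source _).2 hq)]

theorem anchor_apply [LieGroup 𝓘(ℂ, EG) ω G] (x : M) (v : B.atiyah x)
    (p : {p : P // B.proj p = x}) :
    B.anchor x v = tcast 𝓘(ℂ, EM) p.2 (mfderiv IP 𝓘(ℂ, EM) B.proj p.1 (v.1 p)) := by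
  change tcast 𝓘(ℂ, EM) (B.fiber_nonempty x).some.2 (mfderiv IP 𝓘(ℂ, EM) B.proj
    (B.fiber_nonempty x).some.1 (v.1 (B.fiber_nonempty x).some)) = _
  obtain ⟨q, hq⟩ := (B.fiber_nonempty x).some
  obtain ⟨p, rfl⟩ := p
  obtain ⟨g, rfl⟩ := B.exists_act p q hq.symm
  rw [v.2 ⟨p, rfl⟩ g]
  have h1 : B.proj ∘ (fun p' : P => B.act p' g) = B.proj := funext fun p' => B.proj_act p' g
  have h2 := mfderiv_comp (I := IP) (I' := IP) (I'' := 𝓘(ℂ, EM)) p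
    (B.contMDiff_proj.mdifferentiableAt (by simp) : MDifferentiableAt IP 𝓘(ℂ, EM) B.proj (B.act p g))
    ((B.contMDiff_act_right g).mdifferentiableAt (by simp))
  have key : ∀ (f : P → M) (h : f p = B.proj p), f = B.proj →
     tcast 𝓘(ℂ, EM) h (mfderiv IP 𝓘(ℂ, EM) f p (v.1 ⟨p, rfl⟩)) =
      mfderiv IP 𝓘(ℂ, EM) B.proj p (v.1 ⟨p, rfl⟩) := by
    rintro f h rfl; rfl
  have := key _ hq h1
  rw [h2] at this
  exact this

/-- The adjoint bundle: the kernel of the differential of `P → M`, divided by `G`. -/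
def ad (x : M) : Submodule ℂ (B.atiyah x) := LinearMap.ker (B.anchor x)

theorem bracket_mem [LieGroup 𝓘(ℂ, EG) ω G] [IsManifold IP ω P] [FiniteDimensional ℂ EP]
    {U : Set M} (hU : IsOpen U) {s t : ∀ x, B.atiyah x}
    (hs : B.IsHolSection U s) (ht : B.IsHolSection U t) {x : M} (hx : x ∈ U) :
    (fun p : {p : P // B.proj p = x} => mlieBracket IP (B.field s) (B.field t) p.1)
      ∈ B.atiyah x := by
  have : CompleteSpace EP := FiniteDimensional.complete ℂ EP
  rintro ⟨p, rfl⟩ g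
  have hpb : ∀ r : ∀ x, B.atiyah x,
      mpullback IP IP (fun p' : P => B.act p' g) (B.field r) = B.field r := by
    intro r
    funext q
    rw [mpullback_apply, B.field_act]
    exact (B.mfderiv_act_bijective g q).inverse_apply_eq.2 rfl
  have hopen : IsOpen (B.proj ⁻¹' U) := hU.preimage B.contMDiff_proj.continuous
  have hmem : B.act p g ∈ B.proj ⁻¹' U := by simpa [B.proj_act] using hx
  have hd : ∀ r : ∀ x, B.atiyah x, B.IsHolSection U r →
      MDifferentiableAt IP IP.tangent (fun p => (⟨p, B.field r p⟩ : TangentBundle IP P))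
        (B.act p g) := fun r hr =>
    (hr.contMDiffAt (hopen.mem_nhds hmem)).mdifferentiableAt (by simp)
  have h := mpullback_mlieBracket (I := IP) (I' := IP) (n := ω) (x₀ := p)
    (f := fun p' : P => B.act p' g) (hd s hs) (hd t ht) (B.contMDiff_act_right g p) le_top
  rw [hpb, hpb, mpullback_apply] at h
  exact (B.mfderiv_act_bijective g p).inverse_apply_eq.1 h

/-- The Lie bracket of two local sections of the Atiyah bundle, as invariant vector fields. -/
def bracket [LieGroup 𝓘(ℂ, EG) ω G] [IsManifold IP ω P] [FiniteDimensional ℂ EP]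
    {U : Set M} (hU : IsOpen U) {s t : ∀ x, B.atiyah x}
    (hs : B.IsHolSection U s) (ht : B.IsHolSection U t) {x : M} (hx : x ∈ U) : B.atiyah x :=
  ⟨fun p => mlieBracket IP (B.field s) (B.field t) p.1, B.bracket_mem hU hs ht hx⟩

end PrincipalBundle

/-- A complex Lie subgroup `H` of `G`, given by its (not necessarily closed) holomorphic injective
immersion into `G`. -/
structure ComplexLieSubgroup (EH EG : Type*) [NormedAddCommGroup EH] [NormedSpace ℂ EH]
    [NormedAddCommGroup EG] [NormedSpace ℂ EG] (H G : Type*)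
    [TopologicalSpace H] [ChartedSpace EH H] [Group H]
    [TopologicalSpace G] [ChartedSpace EG G] [Group G] where
  incl : H →* G
  injective : Function.Injective incl
  contMDiff : ContMDiff 𝓘(ℂ, EH) 𝓘(ℂ, EG) ω incl
  immersion : ∀ h, Function.Injective (mfderiv 𝓘(ℂ, EH) 𝓘(ℂ, EG) incl h)

variable {EH : Type*} [NormedAddCommGroup EH] [NormedSpace ℂ EH]
  {H : Type*} [TopologicalSpace H] [ChartedSpace EH H] [Group H]

namespace PrincipalBundle

/-- The equivalence relation `(p, g) ~ (p h, h⁻¹ g)` on `P × G`. -/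
def extSetoid (B : PrincipalBundle IP EM EH P M H) (j : ComplexLieSubgroup EH EG H G) :
    Setoid (P × G) where
  r a b := ∃ h : H, b = (B.act a.1 h, (j.incl h)⁻¹ * a.2)
  iseqv :=
    { refl := fun a => ⟨1, by simp [B.act_one]⟩
      symm := by
        rintro a b ⟨h, rfl⟩
        exact ⟨h⁻¹, by simp [← B.act_mul, B.act_one]⟩
      trans := by
        rintro a b c ⟨h, rfl⟩ ⟨k, rfl⟩
        exact ⟨h * k, by simp [← B.act_mul, mul_assoc]⟩ }

/-- The total space `P ×^H G` of the extension of structure group. -/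
def Ext (B : PrincipalBundle IP EM EH P M H) (j : ComplexLieSubgroup EH EG H G) : Type _ :=
  Quotient (B.extSetoid j)

variable (B : PrincipalBundle IP EM EH P M H) (j : ComplexLieSubgroup EH EG H G)

instance : TopologicalSpace (B.Ext j) := inferInstanceAs (TopologicalSpace (Quotient _))

/-- The class of `(p, g)`. -/
def extMk (p : P) (g : G) : B.Ext j := Quotient.mk (B.extSetoid j) (p, g)

theorem extMk_act (p : P) (h : H) (g : G) :
    B.extMk j (B.act p h) g = B.extMk j p (j.incl h * g) :=
  (Quotient.sound (s := B.extSetoid j) ⟨h, by simp⟩).symm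

theorem extMk_surj (q : B.Ext j) : ∃ p g, B.extMk j p g = q := by
  obtain ⟨⟨p, g⟩, rfl⟩ := Quotient.exists_rep q
  exact ⟨p, g, rfl⟩

theorem extMk_eq {p p' : P} {g g' : G} (h : B.extMk j p g = B.extMk j p' g') :
    ∃ k : H, p' = B.act p k ∧ g' = (j.incl k)⁻¹ * g := by
  obtain ⟨k, hk⟩ := Quotient.exact h
  exact ⟨k, by simpa using hk⟩

def extProj : B.Ext j → M :=
  Quotient.lift (fun a : P × G => B.proj a.1) (by rintro a b ⟨h, rfl⟩; exact (B.proj_act _ _).symm)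

@[simp] theorem extProj_mk (p : P) (g : G) : B.extProj j (B.extMk j p g) = B.proj p := rfl

def extAct (q : B.Ext j) (g : G) : B.Ext j :=
  Quotient.lift (fun a : P × G => B.extMk j a.1 (a.2 * g))
    (by rintro a b ⟨h, rfl⟩; simp [extMk_act, mul_assoc]) q

@[simp] theorem extAct_mk (p : P) (g g' : G) :
    B.extAct j (B.extMk j p g) g' = B.extMk j p (g * g') := rfl

open Classical in
/-- The local trivialization `[p, g] ↦ (π p, t(p) g)` of `P ×^H G` defined by a local
trivialization `(π, t)` of `P` (with arbitrary values outside its domain). -/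
def extTrivFun (x : M) : B.Ext j → M × G :=
  Quotient.lift (fun a : P × G => (B.proj a.1,
      if B.proj a.1 ∈ B.baseSet x then j.incl (B.triv x a.1).2 * a.2 else 1)) (by
    rintro a b ⟨h, rfl⟩
    simp only [B.proj_act]
    congr 1
    split_ifs with hx
    · simp [B.triv_act x hx]
    · rfl)

theorem extTrivFun_mk (x : M) {p : P} (hp : B.proj p ∈ B.baseSet x) (g : G) :
    B.extTrivFun j x (B.extMk j p g) = (B.proj p, j.incl (B.triv x p).2 * g) := by
  change (B.proj p, _) = _
  rw [if_pos hp]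

theorem continuous_extMk : Continuous (fun z : P × G => B.extMk j z.1 z.2) := continuous_quot_mk

theorem isQuotientMap_extMk : Topology.IsQuotientMap (fun z : P × G => B.extMk j z.1 z.2) :=
  isQuotientMap_quot_mk

theorem continuous_extProj : Continuous (B.extProj j) :=
  continuous_quot_lift _ (B.contMDiff_proj.continuous.comp continuous_fst)

/-- The local trivialization of `P ×^H G` as a local homeomorphism. -/
def extTriv [LieGroup 𝓘(ℂ, EG) ω G] (x : M) : OpenPartialHomeomorph (B.Ext j) (M × G) where
  toFun := B.extTrivFun j x
  invFun z := B.extMk j ((B.triv x).symm (z.1, 1)) z.2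
  source := B.extProj j ⁻¹' B.baseSet x
  target := B.baseSet x ×ˢ univ
  map_source' := by
    intro q hq
    obtain ⟨p, g, rfl⟩ := B.extMk_surj j q
    rw [B.extTrivFun_mk j x hq]
    exact ⟨hq, trivial⟩
  map_target' := by
    rintro z ⟨hz, -⟩
    change B.proj ((B.triv x).symm (z.1, 1)) ∈ B.baseSet x
    rwa [B.proj_triv_symm x hz]
  left_inv' := by
    intro q hq
    obtain ⟨p, g, rfl⟩ := B.extMk_surj j q
    change B.proj p ∈ B.baseSet x at hq
    rw [B.extTrivFun_mk j x hq]
    simp only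
    rw [← extMk_act, B.act_symm x (by exact hq), one_mul, ← B.triv_eta x hq,
      (B.triv x).left_inv ((B.mem_triv_source x).2 hq)]
  right_inv' := by
    rintro ⟨y, g⟩ ⟨hz, -⟩
    change y ∈ B.baseSet x at hz
    rw [B.extTrivFun_mk j x (by rwa [B.proj_triv_symm x hz]), B.proj_triv_symm x hz,
      (B.triv x).right_inv ((B.mem_triv_target x).2 hz)]
    simp
  open_source := (B.triv_spec x).isOpen.preimage (B.continuous_extProj j)
  open_target := (B.triv_spec x).isOpen.prod isOpen_univ
  continuousOn_toFun := by
    rw [(B.isQuotientMap_extMk j).continuousOn_isOpen_iff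
      ((B.triv_spec x).isOpen.preimage (B.continuous_extProj j))]
    have h1 : ContinuousOn (fun z : P × G => (B.proj z.1, j.incl (B.triv x z.1).2 * z.2))
        ((fun z : P × G => z.1) ⁻¹' (B.triv x).source) := by
      refine (B.contMDiff_proj.continuous.comp continuous_fst).continuousOn.prodMk ?_
      have h2 : ContinuousOn (fun z : P × G => (B.triv x z.1).2)
          ((fun z : P × G => z.1) ⁻¹' (B.triv x).source) :=
        continuous_snd.comp_continuousOn
          ((B.triv x).continuousOn.comp continuous_fst.continuousOn (fun z hz => hz))
      have : ContinuousMul G := continuousMul_of_contMDiffMul 𝓘(ℂ, EG) ω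
      exact (j.contMDiff.continuous.comp_continuousOn h2).mul continuous_snd.continuousOn
    refine (h1.congr ?_).mono ?_
    · intro z hz
      exact B.extTrivFun_mk j x ((B.mem_triv_source x).1 hz) z.2
    · intro z hz
      exact (B.mem_triv_source x).2 hz
  continuousOn_invFun := by
    refine (B.continuous_extMk j).comp_continuousOn (ContinuousOn.prodMk ?_
      continuous_snd.continuousOn)
    refine (B.triv x).continuousOn_symm.comp
      (continuous_fst.prodMk continuous_const).continuousOn ?_
    rintro z ⟨hz, -⟩
    exact (B.mem_triv_target x).2 hz

theorem extTriv_transition [LieGroup 𝓘(ℂ, EG) ω G] (x y : M) :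
    ContMDiffOn (𝓘(ℂ, EM).prod 𝓘(ℂ, EG)) (𝓘(ℂ, EM).prod 𝓘(ℂ, EG)) ω
      ((B.extTriv j x).symm ≫ₕ B.extTriv j y) ((B.extTriv j x).symm ≫ₕ B.extTriv j y).source := by
  have hs : ∀ z ∈ ((B.extTriv j x).symm ≫ₕ B.extTriv j y).source,
      z.1 ∈ B.baseSet x ∧ z.1 ∈ B.baseSet y := by
    rintro z ⟨⟨hz, -⟩, hz'⟩
    refine ⟨hz, ?_⟩
    have : B.proj ((B.triv x).symm (z.1, 1)) ∈ B.baseSet y := hz'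
    rwa [B.proj_triv_symm x hz] at this
  have h1 : ContMDiffOn (𝓘(ℂ, EM).prod 𝓘(ℂ, EG)) IP ω
      (fun z : M × G => (B.triv x).symm (z.1, 1))
      ((B.extTriv j x).symm ≫ₕ B.extTriv j y).source :=
    (B.triv_spec x).contMDiffOn_symm.comp (contMDiff_fst.prodMk contMDiff_const).contMDiffOn
      (fun z hz => (B.mem_triv_target x).2 (hs z hz).1)
  have h2 := (B.triv_spec y).contMDiffOn.comp h1 (fun z hz => (B.mem_triv_source y).2 (by
    rw [B.proj_triv_symm x (hs z hz).1]; exact (hs z hz).2))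
  have h3 : ContMDiffOn (𝓘(ℂ, EM).prod 𝓘(ℂ, EG)) (𝓘(ℂ, EM).prod 𝓘(ℂ, EG)) ω
      (fun z : M × G => (z.1, j.incl (B.triv y ((B.triv x).symm (z.1, 1))).2 * z.2))
      ((B.extTriv j x).symm ≫ₕ B.extTriv j y).source := by
    refine contMDiff_fst.contMDiffOn.prodMk ?_
    refine ContMDiffOn.mul ?_ contMDiff_snd.contMDiffOn
    exact j.contMDiff.comp_contMDiffOn (contMDiff_snd.comp_contMDiffOn h2)
  refine h3.congr (fun z hz => ?_)
  change B.extTrivFun j y (B.extMk j ((B.triv x).symm (z.1, 1)) z.2) = _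
  rw [B.extTrivFun_mk j y (by rw [B.proj_triv_symm x (hs z hz).1]; exact (hs z hz).2),
    B.proj_triv_symm x (hs z hz).1]

/-- The local trivializations as charts of `P ×^H G` with values in `M × G`. -/
abbrev extChartedProd [LieGroup 𝓘(ℂ, EG) ω G] : ChartedSpace (M × G) (B.Ext j) where
  atlas := range (B.extTriv j)
  chartAt q := B.extTriv j (B.extProj j q)
  mem_chart_source q := B.mem_baseSet (B.extProj j q)
  chart_mem_atlas _ := mem_range_self _

/-- The charts of `P ×^H G`: local trivializations followed by product charts of `M × G`. -/
instance [LieGroup 𝓘(ℂ, EG) ω G] : ChartedSpace (ModelProd EM EG) (B.Ext j) :=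
  letI := B.extChartedProd j
  ChartedSpace.comp (ModelProd EM EG) (M × G) (B.Ext j)

instance [LieGroup 𝓘(ℂ, EG) ω G] [IsManifold 𝓘(ℂ, EM) ω M] :
    IsManifold (𝓘(ℂ, EM).prod 𝓘(ℂ, EG)) ω (B.Ext j) := by
  have : IsManifold 𝓘(ℂ, EG) ω G := inferInstance
  refine isManifold_of_contDiffOn _ _ _ ?_
  rintro _ _ ⟨_, ⟨x, rfl⟩, c, hc, rfl⟩ ⟨_, ⟨y, rfl⟩, c', hc', rfl⟩
  have h1 := contMDiffOn_symm_of_mem_maximalAtlas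
    (I := 𝓘(ℂ, EM).prod 𝓘(ℂ, EG)) (n := ω) (IsManifold.subset_maximalAtlas hc)
  have h2 := contMDiffOn_of_mem_maximalAtlas
    (I := 𝓘(ℂ, EM).prod 𝓘(ℂ, EG)) (n := ω) (IsManifold.subset_maximalAtlas hc')
  have h3 := B.extTriv_transition j x y
  set T := (B.extTriv j x).symm ≫ₕ B.extTriv j y with hT
  have h4 : ContMDiffOn (𝓘(ℂ, EM).prod 𝓘(ℂ, EG)) (𝓘(ℂ, EM).prod 𝓘(ℂ, EG)) ω
      (c' ∘ T ∘ c.symm) (c.target ∩ c.symm ⁻¹' (T.source ∩ T ⁻¹' c'.source)) := by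
    refine h2.comp (h3.comp (h1.mono inter_subset_left) ?_) ?_
    · rintro z ⟨-, hz, -⟩; exact hz
    · rintro z ⟨-, -, hz⟩; exact hz
  have h5 := contMDiffOn_iff.1 h4
  refine (h5.2 (0, 0) (0, 0)).congr_mono (fun _ _ => rfl) ?_
  rintro z ⟨⟨⟨hz1, hz2⟩, hz3, hz4⟩, -⟩
  refine ⟨?_, ⟨hz1, ⟨hz2, hz3⟩, hz4⟩, by rw [mem_preimage, extChartAt_source]; exact mem_univ _⟩
  rw [extChartAt_target, ModelWithCorners.range_eq_univ]
  exact ⟨mem_univ _, mem_univ _⟩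

theorem extTriv_contMDiffAt_self [LieGroup 𝓘(ℂ, EG) ω G] [IsManifold 𝓘(ℂ, EM) ω M] (q : B.Ext j) :
    ContMDiffAt (𝓘(ℂ, EM).prod 𝓘(ℂ, EG)) (𝓘(ℂ, EM).prod 𝓘(ℂ, EG)) ω
      (B.extTriv j (B.extProj j q)) q := by
  have hG : IsManifold 𝓘(ℂ, EG) ω G := inferInstance
  set e := B.extTriv j (B.extProj j q) with he
  set c := chartAt (ModelProd EM EG) (e q) with hc
  have h1 : ContMDiffAt (𝓘(ℂ, EM).prod 𝓘(ℂ, EG)) (𝓘(ℂ, EM).prod 𝓘(ℂ, EG)) ω (e ≫ₕ c) q :=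
    contMDiffAt_of_mem_maximalAtlas (I := 𝓘(ℂ, EM).prod 𝓘(ℂ, EG)) (n := ω)
      (IsManifold.chart_mem_maximalAtlas q) (mem_chart_source _ q)
  have h2 : ContMDiffAt (𝓘(ℂ, EM).prod 𝓘(ℂ, EG)) (𝓘(ℂ, EM).prod 𝓘(ℂ, EG)) ω c.symm
      ((e ≫ₕ c) q) :=
    contMDiffAt_symm_of_mem_maximalAtlas (I := 𝓘(ℂ, EM).prod 𝓘(ℂ, EG)) (n := ω)
      (IsManifold.chart_mem_maximalAtlas (e q)) (c.map_source (mem_chart_source _ (e q)))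
  refine (ContMDiffAt.comp q h2 h1).congr_of_eventuallyEq ?_
  filter_upwards [(e ≫ₕ c).open_source.mem_nhds (mem_chart_source (ModelProd EM EG) q)] with r hr
  exact (c.left_inv hr.2).symm

theorem extTriv_symm_contMDiffAt_self [LieGroup 𝓘(ℂ, EG) ω G] [IsManifold 𝓘(ℂ, EM) ω M]
    (q : B.Ext j) :
    ContMDiffAt (𝓘(ℂ, EM).prod 𝓘(ℂ, EG)) (𝓘(ℂ, EM).prod 𝓘(ℂ, EG)) ω
      (B.extTriv j (B.extProj j q)).symm (B.extTriv j (B.extProj j q) q) := by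
  have hG : IsManifold 𝓘(ℂ, EG) ω G := inferInstance
  set e := B.extTriv j (B.extProj j q) with he
  set c := chartAt (ModelProd EM EG) (e q) with hc
  have hq : q ∈ (e ≫ₕ c).source := mem_chart_source (ModelProd EM EG) q
  have h1 : ContMDiffAt (𝓘(ℂ, EM).prod 𝓘(ℂ, EG)) (𝓘(ℂ, EM).prod 𝓘(ℂ, EG)) ω (e ≫ₕ c).symm
      (c (e q)) :=
    contMDiffAt_symm_of_mem_maximalAtlas (I := 𝓘(ℂ, EM).prod 𝓘(ℂ, EG)) (n := ω)
      (IsManifold.chart_mem_maximalAtlas q) ((e ≫ₕ c).map_source hq)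
  have h2 : ContMDiffAt (𝓘(ℂ, EM).prod 𝓘(ℂ, EG)) (𝓘(ℂ, EM).prod 𝓘(ℂ, EG)) ω c (e q) :=
    contMDiffAt_of_mem_maximalAtlas (I := 𝓘(ℂ, EM).prod 𝓘(ℂ, EG)) (n := ω)
      (IsManifold.chart_mem_maximalAtlas (e q)) (mem_chart_source _ (e q))
  refine (ContMDiffAt.comp (e q) h1 h2).congr_of_eventuallyEq ?_
  filter_upwards [c.open_source.mem_nhds (mem_chart_source _ (e q))] with z hz
  exact congrArg e.symm (c.left_inv hz).symm

theorem ext_isPrincipalChart [LieGroup 𝓘(ℂ, EG) ω G] [IsManifold 𝓘(ℂ, EM) ω M] (x : M) :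
    IsPrincipalChart (𝓘(ℂ, EM).prod 𝓘(ℂ, EG)) EM EG (B.extProj j) (B.extAct j) (B.baseSet x)
      (B.extTriv j x) where
  isOpen := (B.triv_spec x).isOpen
  source_eq := rfl
  target_eq := rfl
  fst_eq := by
    intro q hq
    obtain ⟨p, g, rfl⟩ := B.extMk_surj j q
    exact congrArg Prod.fst (B.extTrivFun_mk j x hq g)
  equivariant := by
    intro q hq g'
    obtain ⟨p, g, rfl⟩ := B.extMk_surj j q
    change B.extTrivFun j x (B.extMk j p (g * g')) = _
    rw [B.extTrivFun_mk j x hq]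
    change _ = ((B.extTrivFun j x (B.extMk j p g)).1, (B.extTrivFun j x (B.extMk j p g)).2 * g')
    rw [B.extTrivFun_mk j x hq, mul_assoc]
  contMDiffOn := by
    intro q hq
    refine ContMDiffAt.contMDiffWithinAt ?_
    set e := B.extTriv j (B.extProj j q) with he
    have hqe : q ∈ e.source := B.mem_baseSet (B.extProj j q)
    have hT : e q ∈ (e.symm ≫ₕ B.extTriv j x).source := by
      refine ⟨e.map_source hqe, ?_⟩
      change e.symm (e q) ∈ (B.extTriv j x).source
      rwa [e.left_inv hqe]
    have h1 := (B.extTriv_transition j (B.extProj j q) x).contMDiffAt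
      ((e.symm ≫ₕ B.extTriv j x).open_source.mem_nhds hT)
    refine (ContMDiffAt.comp q h1 (B.extTriv_contMDiffAt_self j q)).congr_of_eventuallyEq ?_
    filter_upwards [e.open_source.mem_nhds hqe] with r hr
    exact congrArg (B.extTriv j x) (e.left_inv hr).symm
  contMDiffOn_symm := by
    intro z hz
    refine ContMDiffAt.contMDiffWithinAt ?_
    set q := (B.extTriv j x).symm z with hq
    set e := B.extTriv j (B.extProj j q) with he
    have hqe : q ∈ e.source := B.mem_baseSet (B.extProj j q)
    have hT : z ∈ ((B.extTriv j x).symm ≫ₕ e).source := ⟨hz, hqe⟩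
    have h1 := (B.extTriv_transition j x (B.extProj j q)).contMDiffAt
      (((B.extTriv j x).symm ≫ₕ e).open_source.mem_nhds hT)
    refine (ContMDiffAt.comp z (B.extTriv_symm_contMDiffAt_self j q) h1).congr_of_eventuallyEq ?_
    filter_upwards [((B.extTriv j x).symm ≫ₕ e).open_source.mem_nhds hT] with r hr
    exact (e.left_inv hr.2).symm

/-- The holomorphic principal `G`-bundle `P ×^H G` obtained from `P` by extending the structure
group along `H ⊂ G`. -/
def ext [LieGroup 𝓘(ℂ, EG) ω G] [IsManifold 𝓘(ℂ, EM) ω M] :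
    PrincipalBundle (𝓘(ℂ, EM).prod 𝓘(ℂ, EG)) EM EG (B.Ext j) M G where
  proj := B.extProj j
  act := B.extAct j
  act_one q := by obtain ⟨p, g, rfl⟩ := B.extMk_surj j q; simp
  act_mul q g h := by obtain ⟨p, g, rfl⟩ := B.extMk_surj j q; simp [mul_assoc]
  proj_act q g := by obtain ⟨p, g, rfl⟩ := B.extMk_surj j q; simp
  locallyTrivial x := ⟨B.baseSet x, B.mem_baseSet x, B.extTriv j x, B.ext_isPrincipalChart j x⟩

section AtExt

variable [LieGroup 𝓘(ℂ, EG) ω G] [IsManifold 𝓘(ℂ, EM) ω M]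

theorem contMDiff_extMk :
    ContMDiff (IP.prod 𝓘(ℂ, EG)) (𝓘(ℂ, EM).prod 𝓘(ℂ, EG)) ω
      (fun z : P × G => B.extMk j z.1 z.2) := by
  rintro ⟨p, g⟩
  set x := B.proj p with hx
  have hp := (B.mem_triv_source x).2 (B.mem_baseSet x)
  have h1 := ((B.triv_spec x).contMDiffOn.contMDiffAt ((B.triv x).open_source.mem_nhds hp))
  have h1' : ContMDiffAt (IP.prod 𝓘(ℂ, EG)) (𝓘(ℂ, EM).prod 𝓘(ℂ, EH)) ω
      (fun z : P × G => B.triv x z.1) (p, g) := h1.comp (p, g) contMDiffAt_fst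
  have h2 : ContMDiffAt (IP.prod 𝓘(ℂ, EG)) (𝓘(ℂ, EM).prod 𝓘(ℂ, EG)) ω
      (fun z : P × G => (B.proj z.1, j.incl (B.triv x z.1).2 * z.2)) (p, g) := by
    refine ContMDiffAt.prodMk ((B.contMDiff_proj p).comp (p, g) contMDiffAt_fst) ?_
    refine ContMDiffAt.mul ?_ contMDiffAt_snd
    exact (j.contMDiff _).comp (p, g) (contMDiffAt_snd.comp (p, g) h1')
  have ht : (B.proj p, j.incl (B.triv x p).2 * g) ∈ (B.extTriv j x).target :=
    ⟨B.mem_baseSet x, trivial⟩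
  have h3 := ((B.ext_isPrincipalChart j x).contMDiffOn_symm.contMDiffAt
    ((B.extTriv j x).open_target.mem_nhds ht))
  refine (ContMDiffAt.comp (p, g) h3 h2).congr_of_eventuallyEq ?_
  have : ∀ᶠ z : P × G in 𝓝 (p, g), z.1 ∈ (B.triv x).source :=
    continuousAt_fst.eventually ((B.triv x).open_source.mem_nhds hp)
  filter_upwards [this] with z hz
  have hz' := (B.mem_triv_source x).1 hz
  have := (B.extTriv j x).left_inv (x := B.extMk j z.1 z.2) hz'
  rw [← this]
  exact congrArg _ (B.extTrivFun_mk j x hz' z.2)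

theorem contMDiff_extMk_right (g : G) :
    ContMDiff IP (𝓘(ℂ, EM).prod 𝓘(ℂ, EG)) ω (fun p : P => B.extMk j p g) :=
  (B.contMDiff_extMk j).comp (contMDiff_id.prodMk contMDiff_const)

/-- Derivative of `p ↦ [p, g]` on an invariant field along a fibre, in terms of `[p, g]` only. -/
theorem extDeriv_wd [LieGroup 𝓘(ℂ, EH) ω H] {x : M} (v : B.atiyah x)
    (a b : {p : P // B.proj p = x})
    {g g' : G} (h : B.extMk j a.1 g = B.extMk j b.1 g') :
    tcast (𝓘(ℂ, EM).prod 𝓘(ℂ, EG)) h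
      (mfderiv IP (𝓘(ℂ, EM).prod 𝓘(ℂ, EG)) (fun p : P => B.extMk j p g) a.1 (v.1 a)) =
    mfderiv IP (𝓘(ℂ, EM).prod 𝓘(ℂ, EG)) (fun p : P => B.extMk j p g') b.1 (v.1 b) := by
  obtain ⟨a, rfl⟩ := a
  obtain ⟨b, hb⟩ := b
  obtain ⟨k, hk, hg⟩ := B.extMk_eq j h
  dsimp only at hk
  subst hk hg
  rw [v.2 ⟨a, rfl⟩ k]
  have h2 := mfderiv_comp (I := IP) (I' := IP) (I'' := 𝓘(ℂ, EM).prod 𝓘(ℂ, EG)) a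
    ((B.contMDiff_extMk_right j ((j.incl k)⁻¹ * g)).mdifferentiableAt (by simp) :
      MDifferentiableAt IP (𝓘(ℂ, EM).prod 𝓘(ℂ, EG)) _ (B.act a k))
    ((B.contMDiff_act_right k).mdifferentiableAt (by simp))
  have h1 : (fun p : P => B.extMk j p ((j.incl k)⁻¹ * g)) ∘ (fun p' : P => B.act p' k) =
      (fun p : P => B.extMk j p g) := by
    funext p; simp [extMk_act]
  have key : ∀ (f : P → B.Ext j) (h : B.extMk j a g = f a), f = (fun p : P => B.extMk j p g) →
     tcast (𝓘(ℂ, EM).prod 𝓘(ℂ, EG)) h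
       (mfderiv IP (𝓘(ℂ, EM).prod 𝓘(ℂ, EG)) (fun p : P => B.extMk j p g) a (v.1 ⟨a, rfl⟩)) =
      mfderiv IP (𝓘(ℂ, EM).prod 𝓘(ℂ, EG)) f a (v.1 ⟨a, rfl⟩) := by
    rintro f h rfl; rfl
  have := key _ h h1
  rw [h2] at this
  exact this

/-- A representative `(p, g)` of a point of `P ×^H G` over `x`, with `p` over `x`. -/
def extRep (x : M) (q : {q : B.Ext j // (B.ext j).proj q = x}) : {p : P // B.proj p = x} × G :=
  (⟨(B.extMk_surj j q.1).choose, by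
    exact (congrArg (B.extProj j) (B.extMk_surj j q.1).choose_spec.choose_spec).trans q.2⟩, (B.extMk_surj j q.1).choose_spec.choose)

theorem extRep_spec (x : M) (q : {q : B.Ext j // (B.ext j).proj q = x}) :
    B.extMk j (B.extRep j x q).1.1 (B.extRep j x q).2 = q.1 :=
  (B.extMk_surj j q.1).choose_spec.choose_spec

/-- The field of tangent vectors along the fibre of `P ×^H G` over `x` that is equal to the
differential of `p ↦ [p, g]` applied to `v` at the point `[p, g]` (see `extVal_mk`). -/
def extVal (x : M) (v : B.atiyah x) (q : {q : B.Ext j // (B.ext j).proj q = x}) :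
    TangentSpace (𝓘(ℂ, EM).prod 𝓘(ℂ, EG)) q.1 :=
  tcast (𝓘(ℂ, EM).prod 𝓘(ℂ, EG)) (B.extRep_spec j x q)
    (mfderiv IP (𝓘(ℂ, EM).prod 𝓘(ℂ, EG)) (fun p : P => B.extMk j p (B.extRep j x q).2)
      (B.extRep j x q).1.1 (v.1 (B.extRep j x q).1))

variable [LieGroup 𝓘(ℂ, EH) ω H]

theorem extVal_mk {x : M} (v : B.atiyah x) (p : P) (hp : B.proj p = x) (g : G) :
    B.extVal j x v ⟨B.extMk j p g, hp⟩ =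
      mfderiv IP (𝓘(ℂ, EM).prod 𝓘(ℂ, EG)) (fun p' : P => B.extMk j p' g) p (v.1 ⟨p, hp⟩) :=
  B.extDeriv_wd j v (B.extRep j x ⟨B.extMk j p g, hp⟩).1 ⟨p, hp⟩
    (B.extRep_spec j x ⟨B.extMk j p g, hp⟩)

theorem extVal_mem {x : M} (v : B.atiyah x) : B.extVal j x v ∈ (B.ext j).atiyah x := by
  rintro ⟨q, hq⟩ g'
  obtain ⟨p, g, rfl⟩ := B.extMk_surj j q
  change B.extVal j x v ⟨B.extMk j p (g * g'), hq⟩ = _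
  rw [B.extVal_mk j v p hq, B.extVal_mk j v p hq]
  have h2 := mfderiv_comp (I := IP) (I' := 𝓘(ℂ, EM).prod 𝓘(ℂ, EG))
    (I'' := 𝓘(ℂ, EM).prod 𝓘(ℂ, EG)) p
    (((B.ext j).contMDiff_act_right g').mdifferentiableAt (by simp) :
      MDifferentiableAt _ _ _ (B.extMk j p g))
    ((B.contMDiff_extMk_right j g).mdifferentiableAt (by simp))
  exact congrArg (fun L => L (v.1 ⟨p, hq⟩)) h2

/-- The linear map `At(P) → At(P ×^H G)` induced by the differential of the inclusion
`p ↦ [p, 1]`, and of its translates `p ↦ [p, g]`. -/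
def atiyahExt (x : M) : B.atiyah x →ₗ[ℂ] (B.ext j).atiyah x where
  toFun v := ⟨B.extVal j x v, B.extVal_mem j v⟩
  map_add' v w := by
    refine Subtype.ext (funext fun q => ?_)
    simp [extVal]
  map_smul' c v := by
    refine Subtype.ext (funext fun q => ?_)
    simp [extVal]

theorem atiyahExt_apply {x : M} (v : B.atiyah x) (p : P) (hp : B.proj p = x) (g : G) :
    (B.atiyahExt j x v).1 ⟨B.extMk j p g, hp⟩ =
      mfderiv IP (𝓘(ℂ, EM).prod 𝓘(ℂ, EG)) (fun p' : P => B.extMk j p' g) p (v.1 ⟨p, hp⟩) :=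
  B.extVal_mk j v p hp g

theorem anchor_atiyahExt (x : M) (v : B.atiyah x) :
    (B.ext j).anchor x (B.atiyahExt j x v) = B.anchor x v := by
  obtain ⟨p, rfl⟩ := B.fiber_nonempty x
  have h1 := (B.ext j).anchor_apply (B.proj p) (B.atiyahExt j (B.proj p) v) ⟨B.extMk j p 1, rfl⟩
  rw [B.atiyahExt_apply j v p rfl 1] at h1
  rw [h1, B.anchor_apply _ _ ⟨p, rfl⟩]
  have h2 := mfderiv_comp (I := IP) (I' := 𝓘(ℂ, EM).prod 𝓘(ℂ, EG)) (I'' := 𝓘(ℂ, EM)) p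
    ((B.ext j).contMDiff_proj.mdifferentiableAt (by simp) :
      MDifferentiableAt _ 𝓘(ℂ, EM) _ (B.extMk j p 1))
    ((B.contMDiff_extMk_right j 1).mdifferentiableAt (by simp))
  exact (congrArg (fun L => L (v.1 ⟨p, rfl⟩)) h2).symm

theorem isHolSection_atiyahExt [IsManifold IP ω P] {U : Set M} (hU : IsOpen U)
    {s : ∀ x, B.atiyah x} (hs : B.IsHolSection U s) :
    (B.ext j).IsHolSection U (fun x => B.atiyahExt j x (s x)) := by
  have hG : IsManifold 𝓘(ℂ, EG) ω G := inferInstance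
  intro q₀ hq₀
  refine ContMDiffAt.contMDiffWithinAt ?_
  set x := (B.ext j).proj q₀ with hx
  set e := B.extTriv j x with he
  have hqe : q₀ ∈ e.source := B.mem_baseSet x
  have hxt : ((x, 1) : M × H) ∈ (B.triv x).target := (B.mem_triv_target x).2 (B.mem_baseSet x)
  -- the local section `y ↦ triv⁻¹ (y, 1)` and the group coordinate
  have hσ0 : ContMDiffAt 𝓘(ℂ, EM) IP ω (fun y : M => (B.triv x).symm (y, 1)) x :=
    ContMDiffAt.comp x ((B.triv_spec x).contMDiffOn_symm.contMDiffAt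
      ((B.triv x).open_target.mem_nhds hxt)) (contMDiffAt_id.prodMk contMDiffAt_const)
  have hσ : ContMDiffAt (𝓘(ℂ, EM).prod 𝓘(ℂ, EG)) IP ω
      (fun q => (B.triv x).symm ((B.ext j).proj q, 1)) q₀ :=
    ContMDiffAt.comp (g := fun y : M => (B.triv x).symm (y, 1)) q₀ hσ0 ((B.ext j).contMDiff_proj q₀)
  have hγ : ContMDiffAt (𝓘(ℂ, EM).prod 𝓘(ℂ, EG)) 𝓘(ℂ, EG) ω (fun q => (e q).2) q₀ :=
    contMDiffAt_snd.comp q₀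
      ((B.ext_isPrincipalChart j x).contMDiffOn.contMDiffAt (e.open_source.mem_nhds hqe))
  have hps : B.proj ((B.triv x).symm (x, 1)) = x := B.proj_triv_symm x (B.mem_baseSet x)
  have hopen : IsOpen (B.proj ⁻¹' U) := hU.preimage B.contMDiff_proj.continuous
  have h1 := hs.contMDiffAt (x := (B.triv x).symm (x, 1)) (hopen.mem_nhds (by
    change B.proj _ ∈ U; rw [hps]; exact hq₀))
  have h2 := ContMDiffAt.comp q₀ h1 hσ
  have hzero : ContMDiff 𝓘(ℂ, EG) 𝓘(ℂ, EG).tangent ω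
      (fun g : G => (⟨g, 0⟩ : TangentBundle 𝓘(ℂ, EG) G)) :=
    Bundle.contMDiff_zeroSection ℂ (TangentSpace 𝓘(ℂ, EG) : G → Type _)
  have h3 := ContMDiffAt.comp q₀ (hzero _) hγ
  have h4 := (contMDiff_equivTangentBundleProd_symm (I := IP) (I' := 𝓘(ℂ, EG)) (M := P) (M' := G)
    (n := ω)).contMDiffAt.comp q₀ (h2.prodMk h3)
  have h5 := ((B.contMDiff_extMk j).contMDiff_tangentMap (m := ω) le_top).contMDiffAt.comp q₀ h4
  refine h5.congr_of_eventuallyEq ?_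
  filter_upwards [e.open_source.mem_nhds hqe] with q hq
  set p := (B.triv x).symm ((B.ext j).proj q, 1) with hp
  set g := (e q).2 with hg
  have hqeq : B.extMk j p g = q := by
    have h := e.left_inv hq
    have h' := (B.ext_isPrincipalChart j x).fst_eq q hq
    change B.extMk j ((B.triv x).symm ((e q).1, 1)) (e q).2 = q at h
    rwa [h'] at h
  have hd : mfderiv IP (𝓘(ℂ, EM).prod 𝓘(ℂ, EG)) (fun p' : P => B.extMk j p' g) p (B.field s p) =
      mfderiv (IP.prod 𝓘(ℂ, EG)) (𝓘(ℂ, EM).prod 𝓘(ℂ, EG)) (fun z : P × G => B.extMk j z.1 z.2)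
        (p, g) (B.field s p, 0) := by
    have h := mfderiv_comp (I := IP) (I' := IP.prod 𝓘(ℂ, EG)) (I'' := 𝓘(ℂ, EM).prod 𝓘(ℂ, EG))
      (f := fun p' : P => (p', g)) p
      ((B.contMDiff_extMk j).mdifferentiableAt (by simp) : MDifferentiableAt _ _ _ (p, g))
      ((contMDiff_id.prodMk contMDiff_const : ContMDiff IP (IP.prod 𝓘(ℂ, EG)) ω
        (fun p' : P => (p', g))).mdifferentiableAt (by simp))
    rw [mfderiv_prod_left] at h
    exact congrArg (fun L => L (B.field s p)) h
  have key : ∀ q' (h : B.extMk j p g = q'),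
      (⟨q', (B.ext j).field (fun x => B.atiyahExt j x (s x)) q'⟩ :
        TangentBundle (𝓘(ℂ, EM).prod 𝓘(ℂ, EG)) (B.Ext j)) =
      ⟨B.extMk j p g, mfderiv (IP.prod 𝓘(ℂ, EG)) (𝓘(ℂ, EM).prod 𝓘(ℂ, EG))
        (fun z : P × G => B.extMk j z.1 z.2) (p, g) (B.field s p, 0)⟩ := by
    rintro _ rfl
    rw [← hd]
    exact congrArg _ (B.atiyahExt_apply j (s (B.proj p)) p rfl g)
  exact key q hqeq

/-- The map `ad(P) → ad(P ×^H G)` induced by the inclusion of the Lie algebra of `H` in that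
of `G`. -/
def adExt (x : M) : B.ad x →ₗ[ℂ] (B.ext j).ad x :=
  (B.atiyahExt j x).restrict (fun v hv => by
    rw [ad, LinearMap.mem_ker] at hv ⊢
    rw [B.anchor_atiyahExt, hv])

/-- The map `ad(P ×^H G) ⊕ At(P) → At(P ×^H G)` whose kernel is the image of `ad(P)`. -/
def atiyahSum (x : M) : ((B.ext j).ad x × B.atiyah x) →ₗ[ℂ] (B.ext j).atiyah x :=
  ((B.ext j).ad x).subtype.coprod (B.atiyahExt j x)

/-- The map `ad(P) → ad(P ×^H G) ⊕ At(P)`, `v ↦ (v, -v)`. -/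
def adAntidiagonal (x : M) : B.ad x →ₗ[ℂ] ((B.ext j).ad x × B.atiyah x) :=
  (B.adExt j x).prod (-(B.ad x).subtype)

end AtExt
end PrincipalBundle

section Foliation

variable [IsManifold 𝓘(ℂ, EM) ω M]

/-- A (nonsingular) holomorphic foliation of complex codimension `n`, given by its tangent
distribution: a holomorphic subbundle of `TM` stable under the Lie bracket. -/
structure Foliation (EM M : Type*) [NormedAddCommGroup EM] [NormedSpace ℂ EM]
    [TopologicalSpace M] [ChartedSpace EM M] [IsManifold 𝓘(ℂ, EM) ω M] (n : ℕ) where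
  T : ∀ x : M, Submodule ℂ (TangentSpace 𝓘(ℂ, EM) x)
  exists_frame : ∀ x₀ : M, ∃ U : Set M, IsOpen U ∧ x₀ ∈ U ∧
    ∃ k : ℕ, k + n = Module.finrank ℂ EM ∧
      ∃ X : Fin k → ∀ x : M, TangentSpace 𝓘(ℂ, EM) x,
        (∀ i, IsHolField 𝓘(ℂ, EM) U (X i)) ∧
        ∀ x ∈ U, LinearIndependent ℂ (fun i => X i x) ∧
          Submodule.span ℂ (range fun i => X i x) = T x
  involutive : ∀ U : Set M, IsOpen U → ∀ X Y : ∀ x : M, TangentSpace 𝓘(ℂ, EM) x,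
    IsHolField 𝓘(ℂ, EM) U X → IsHolField 𝓘(ℂ, EM) U Y →
    (∀ x ∈ U, X x ∈ T x) → (∀ x ∈ U, Y x ∈ T x) →
    ∀ x ∈ U, mlieBracket 𝓘(ℂ, EM) X Y x ∈ T x

/-- A partial holomorphic connection on `P` in the direction of a distribution `T ⊂ TM`: a
holomorphic homomorphism `T → At(P)` splitting the Atiyah sequence over `T`. A fibrewise linear
map is a holomorphic homomorphism when it sends holomorphic local sections to holomorphic local
sections. -/
structure PartialConnection [IsManifold IP ω P] (B : PrincipalBundle IP EM EG P M G)
    (T : ∀ x : M, Submodule ℂ (TangentSpace 𝓘(ℂ, EM) x)) where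
  lift : ∀ x, T x →ₗ[ℂ] B.atiyah x
  anchor_lift : ∀ x (X : T x), B.anchor x (lift x X) = X
  holomorphic : ∀ U : Set M, IsOpen U → ∀ X : ∀ x, T x,
    IsHolField 𝓘(ℂ, EM) U (fun x => (X x : TangentSpace 𝓘(ℂ, EM) x)) →
    B.IsHolSection U (fun x => lift x (X x))

namespace PartialConnection

variable [IsManifold IP ω P] [LieGroup 𝓘(ℂ, EG) ω G] [FiniteDimensional ℂ EP]
  {B : PrincipalBundle IP EM EG P M G} {T : ∀ x : M, Submodule ℂ (TangentSpace 𝓘(ℂ, EM) x)}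

/-- Flatness of a partial connection `lam`: its curvature `p([lam X, lam Y])` vanishes for all
local holomorphic sections `X`, `Y` of `T`, where `p` is the projection onto `ad(P)` whose kernel is
the image of `lam`. -/
def IsFlat (lam : PartialConnection B T) : Prop :=
  ∀ (U : Set M) (hU : IsOpen U) (X Y : ∀ x, T x)
    (hX : IsHolField 𝓘(ℂ, EM) U (fun x => (X x : TangentSpace 𝓘(ℂ, EM) x)))
    (hY : IsHolField 𝓘(ℂ, EM) U (fun x => (Y x : TangentSpace 𝓘(ℂ, EM) x)))
    (x : M) (hx : x ∈ U),
    B.bracket hU (lam.holomorphic U hU X hX) (lam.holomorphic U hU Y hY) hx ∈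
      LinearMap.range (lam.lift x)

end PartialConnection

/-- A holomorphic connection on `P`: a holomorphic splitting of the Atiyah sequence. -/
abbrev Connection [IsManifold IP ω P] (B : PrincipalBundle IP EM EG P M G) :=
  PartialConnection B (fun _ => ⊤)

namespace Connection

variable [IsManifold IP ω P] {B : PrincipalBundle IP EM EG P M G}

/-- The restriction of a connection to a distribution. -/
def restrict (D : Connection B) (T : ∀ x : M, Submodule ℂ (TangentSpace 𝓘(ℂ, EM) x)) :
    PartialConnection B T where
  lift x := D.lift x ∘ₗ Submodule.inclusion le_top
  anchor_lift x X := D.anchor_lift x (Submodule.inclusion le_top X)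
  holomorphic U hU X hX := D.holomorphic U hU (fun x => Submodule.inclusion le_top (X x)) hX

/-- The contraction of the curvature `X, Y ↦ p([D X, D Y])` of a connection `D` with the vectors of
the distribution `T` vanishes; here `p` is the projection `At(P) → ad(P)`, with kernel the image
of `D`. -/
def CurvatureVanishesAlong [LieGroup 𝓘(ℂ, EG) ω G] [FiniteDimensional ℂ EP] (D : Connection B)
    (T : ∀ x : M, Submodule ℂ (TangentSpace 𝓘(ℂ, EM) x)) : Prop :=
  ∀ (U : Set M) (hU : IsOpen U) (X : ∀ x, T x)
    (Y : ∀ x, (⊤ : Submodule ℂ (TangentSpace 𝓘(ℂ, EM) x)))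
    (hX : IsHolField 𝓘(ℂ, EM) U (fun x => (X x : TangentSpace 𝓘(ℂ, EM) x)))
    (hY : IsHolField 𝓘(ℂ, EM) U (fun x => (Y x : TangentSpace 𝓘(ℂ, EM) x)))
    (x : M) (hx : x ∈ U),
    B.bracket hU ((D.restrict T).holomorphic U hU X hX) (D.holomorphic U hU Y hY) hx ∈
      LinearMap.range (D.lift x)

/-- The projection `At(P) → ad(P)` of a connection: the identity on `ad(P)`, with kernel the image
of the splitting. -/
def form (D : Connection B) (x : M) : B.atiyah x →ₗ[ℂ] B.ad x :=
  (LinearMap.id - D.lift x ∘ₗ (B.anchor x).codRestrict ⊤ (fun _ => trivial)).codRestrict (B.ad x)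
    (fun v => by
      rw [PrincipalBundle.ad, LinearMap.mem_ker, LinearMap.sub_apply, map_sub, LinearMap.comp_apply,
        D.anchor_lift]
      exact sub_self _)

end Connection

/-- The partial connection on `P ×^H G` induced by a partial connection on `P`. -/
def PartialConnection.induce [IsManifold IP ω P] [LieGroup 𝓘(ℂ, EH) ω H] [LieGroup 𝓘(ℂ, EG) ω G]
    {B : PrincipalBundle IP EM EH P M H} {T : ∀ x : M, Submodule ℂ (TangentSpace 𝓘(ℂ, EM) x)}
    (lam : PartialConnection B T) (j : ComplexLieSubgroup EH EG H G) :
    PartialConnection (B.ext j) T where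
  lift x := B.atiyahExt j x ∘ₗ lam.lift x
  anchor_lift x X := by
    rw [LinearMap.comp_apply, B.anchor_atiyahExt, lam.anchor_lift]
  holomorphic U hU X hX := B.isHolSection_atiyahExt j hU (lam.holomorphic U hU X hX)

/-- A transverse generalized holomorphic Cartan geometry with model `(G, H)` on a manifold with
holomorphic foliation `F`, and with underlying principal `H`-bundle `B`. -/
structure TransverseCartan [IsManifold IP ω P] [LieGroup 𝓘(ℂ, EH) ω H] [LieGroup 𝓘(ℂ, EG) ω G]
    [FiniteDimensional ℂ EP] [FiniteDimensional ℂ EM] [FiniteDimensional ℂ EG] {n : ℕ}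
    (F : Foliation EM M n) (B : PrincipalBundle IP EM EH P M H)
    (j : ComplexLieSubgroup EH EG H G) where
  /-- the partial connection `λ` along the foliation -/
  lam : PartialConnection B F.T
  flat : lam.IsFlat
  /-- the homomorphism `β : At(P) / λ(TF) → ad(P ×^H G)` -/
  beta : ∀ x, (B.atiyah x ⧸ LinearMap.range (lam.lift x)) →ₗ[ℂ] (B.ext j).ad x
  beta_holomorphic : ∀ U : Set M, IsOpen U → ∀ s : ∀ x, B.atiyah x, B.IsHolSection U s →
    (B.ext j).IsHolSection U
      (fun x => (beta x (Submodule.Quotient.mk (s x)) : (B.ext j).atiyah x))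
  /-- `β` restricts to the inclusion `ad(P) → ad(P ×^H G)` -/
  beta_ad : ∀ x (v : B.ad x),
    beta x (Submodule.Quotient.mk (v : B.atiyah x)) = B.adExt j x v
  /-- `β` preserves the partial connections along the foliation: that of `At(P) / λ(TF)`, which is
  `∇_X s = [λ X, s]` modulo `λ(TF)`, and that of `ad(P ×^H G)`, which is `∇_X w = [λ' X, w]` for
  the partial connection `λ'` on `P ×^H G` induced by `λ`. -/
  beta_parallel : ∀ (U : Set M) (hU : IsOpen U) (X : ∀ x, F.T x)
    (hX : IsHolField 𝓘(ℂ, EM) U (fun x => (X x : TangentSpace 𝓘(ℂ, EM) x)))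
    (s : ∀ x, B.atiyah x) (hs : B.IsHolSection U s) (x : M) (hx : x ∈ U),
    (beta x (Submodule.Quotient.mk (B.bracket hU (lam.holomorphic U hU X hX) hs hx)) :
        (B.ext j).atiyah x) =
      (B.ext j).bracket hU ((lam.induce j).holomorphic U hU X hX)
        (beta_holomorphic U hU s hs) hx

end Foliation
end TransverseCartanGeometry

end

open TransverseCartanGeometry

/-! A tangent vector `X` of `M` is the image of some `v` in `At(E_H)`, and the connection must be
`D(X) = i(v) - β([v])`. Two choices of `v` differ by some `u` in `ad(E_H)`, where `i(u) = ι(u) =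
β([u])`, so `D` is well defined. It splits the Atiyah sequence because `i` respects the projections
to `TM` and `β` takes vertical values. Subtracting `D` of the image of `w + i(v)` in `TM` from `w +
i(v)` itself leaves `w + β([v])`, the prescribed projection. That projection determines `D`, since
`D(da) = a - φ(a)` and every tangent vector is some `da`. The description of `At(E_G)` as a quotient
follows in the same way from surjectivity of `At(E_H) → TM`. Holomorphy of `D` is local and uses the
holomorphic lifts that are horizontal in a local trivialization (`trivSection`).

Along the foliation one may take `v = λX`, whose class is zero, so `D(X) = i(λX)`. For `s` lifting
an arbitrary field `Y`, compatibility of `i` with brackets and the assumption that `β` is parallel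
give `[DX, DY] = i([λX, s]) - [i(λX), β([s])] = i([λX, s]) - β([[λX, s]])`. The right side is `D` of
the image of `[λX, s]` in `TM`, so the curvature contracted with `X` is zero. Flatness of `D` on
`TF` comes from flatness of `λ` by the same compatibility.

The analytic input is therefore `bracket_atiyahExt`. The maps `p ↦ [p, g]` need not be local
biholomorphisms, so fields cannot simply be pulled back along them. The argument uses related fields
instead (`mfderiv_mlieBracket_of_related`). -/

/-! ### Lie brackets of vector fields related by a map -/

section Related

variable {𝕜 : Type*} [NontriviallyNormedField 𝕜]
  {E : Type*} [NormedAddCommGroup E] [NormedSpace 𝕜 E]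
  {E' : Type*} [NormedAddCommGroup E'] [NormedSpace 𝕜 E']

/-- Differentiate the relation `Df(A) = A' ∘ f` at `x` in a direction `u`. Taking `A = W`, `u = V x`
and `A = V`, `u = W x` and subtracting, the two terms in `D²f` cancel by symmetry. -/
theorem fderiv_lieBracket_of_related {f : E → E'} {V W : E → E} {V' W' : E' → E'} {x : E}
    (hf : ContDiffAt 𝕜 2 f x) (hsymm : IsSymmSndFDerivAt 𝕜 f x)
    (hV : DifferentiableAt 𝕜 V x) (hW : DifferentiableAt 𝕜 W x)
    (hV' : DifferentiableAt 𝕜 V' (f x)) (hW' : DifferentiableAt 𝕜 W' (f x))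
    (hVV' : ∀ᶠ y in 𝓝 x, fderiv 𝕜 f y (V y) = V' (f y))
    (hWW' : ∀ᶠ y in 𝓝 x, fderiv 𝕜 f y (W y) = W' (f y)) :
    fderiv 𝕜 f x (lieBracket 𝕜 V W x) = lieBracket 𝕜 V' W' (f x) := by
  have hdf : DifferentiableAt 𝕜 (fderiv 𝕜 f) x :=
    (hf.fderiv_right (m := 1) (by norm_num)).differentiableAt one_ne_zero
  have key : ∀ {A : E → E} {A' : E' → E'}, DifferentiableAt 𝕜 A x →
      DifferentiableAt 𝕜 A' (f x) → (∀ᶠ y in 𝓝 x, fderiv 𝕜 f y (A y) = A' (f y)) → ∀ u,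
      fderiv 𝕜 f x (fderiv 𝕜 A x u) + fderiv 𝕜 (fderiv 𝕜 f) x u (A x) =
        fderiv 𝕜 A' (f x) (fderiv 𝕜 f x u) := by
    intro A A' hA hA' h u
    have h1 := hdf.hasFDerivAt.clm_apply hA.hasFDerivAt
    have h2 := hA'.hasFDerivAt.comp x (hf.differentiableAt two_ne_zero).hasFDerivAt
    have h3 := (h1.congr_of_eventuallyEq (h.mono fun y hy => hy.symm :
      (A' ∘ f) =ᶠ[𝓝 x] fun y => fderiv 𝕜 f y (A y))).unique h2
    simpa using congrArg (fun L => L u) h3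
  have h1 := key hW hW' hWW' (V x)
  have h2 := key hV hV' hVV' (W x)
  change fderiv 𝕜 f x (fderiv 𝕜 W x (V x) - fderiv 𝕜 V x (W x)) =
    fderiv 𝕜 W' (f x) (V' (f x)) - fderiv 𝕜 V' (f x) (W' (f x))
  rw [map_sub, ← hVV'.self_of_nhds, ← hWW'.self_of_nhds, ← h1, ← h2,
    hsymm.eq]
  abel

variable {H : Type*} [TopologicalSpace H] {I : ModelWithCorners 𝕜 E H}
  {N : Type*} [TopologicalSpace N] [ChartedSpace H N]
  {H' : Type*} [TopologicalSpace H'] {I' : ModelWithCorners 𝕜 E' H'}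
  {N' : Type*} [TopologicalSpace N'] [ChartedSpace H' N']

variable (I) in
/-- The expression of a vector field in the chart at `x`. -/
noncomputable def chartField (x : N) (V : ∀ x : N, TangentSpace I x) : E → E :=
  mpullbackWithin 𝓘(𝕜, E) I (extChartAt I x).symm V (range I)

/-- The pullback involves the inverse of the derivative of `φ⁻¹`, which is the derivative of `φ`.
The formula holds on the whole chart target, as needed to differentiate it. -/
theorem chartField_apply [IsManifold I 1 N] (V : ∀ x : N, TangentSpace I x)
    {x : N} {y : E} (hy : y ∈ (extChartAt I x).target) :
    chartField I x V y = mfderiv I 𝓘(𝕜, E) (extChartAt I x) ((extChartAt I x).symm y)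
        (V ((extChartAt I x).symm y)) :=
  (isInvertible_mfderivWithin_extChartAt_symm hy).inverse_apply_eq.2
    (congrArg (fun L => L (V ((extChartAt I x).symm y)))
      (mfderivWithin_extChartAt_symm_comp_mfderiv_extChartAt hy)).symm

theorem differentiableAt_chartField [IsManifold I 2 N] [I.Boundaryless] [CompleteSpace E]
    {V : ∀ x : N, TangentSpace I x} {x : N}
    (hV : MDifferentiableAt I I.tangent (fun x => (⟨x, V x⟩ : TangentBundle I N)) x) :
    DifferentiableAt 𝕜 (chartField I x V) (extChartAt I x x) := by
  have h := (hV.mdifferentiableWithinAt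
    (s := univ)).differentiableWithinAt_mpullbackWithin_vectorField
  refine DifferentiableWithinAt.differentiableAt (s := (extChartAt I x).symm ⁻¹' univ ∩ range I)
    h ?_
  simp [I.range_eq_univ]

/-- By definition the bracket on a manifold is the chart bracket carried back by the inverse of the
derivative of the chart, and applying that derivative undoes this. Without boundary, the bracket
within the model range is the ordinary one. -/
theorem mfderiv_extChartAt_mlieBracket [IsManifold I 1 N] [I.Boundaryless]
    (V W : ∀ x : N, TangentSpace I x) (x : N) :
    mfderiv I 𝓘(𝕜, E) (extChartAt I x) x (mlieBracket I V W x) =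
      lieBracket 𝕜 (E := E) (chartField I x V) (chartField I x W) (extChartAt I x x) := by
  have hs : (extChartAt I x).symm ⁻¹' univ ∩ range I = univ := by simp [I.range_eq_univ]
  have h : mlieBracket I V W x = (mfderiv I 𝓘(𝕜, E) (extChartAt I x) x).inverse
      (lieBracketWithin 𝕜 (E := E) (chartField I x V) (chartField I x W)
        ((extChartAt I x).symm ⁻¹' univ ∩ range I) (extChartAt I x x)) := rfl
  rw [hs, lieBracketWithin_univ] at h
  have key : ∀ u : TangentSpace 𝓘(𝕜, E) (extChartAt I x x),
      mlieBracket I V W x = (mfderiv I 𝓘(𝕜, E) (extChartAt I x) x).inverse u →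
      mfderiv I 𝓘(𝕜, E) (extChartAt I x) x (mlieBracket I V W x) = u := fun u hu =>
    ((isInvertible_mfderiv_extChartAt (mem_extChartAt_source x)).inverse_apply_eq.1 hu.symm).symm
  exact key _ h

/-- The differential of a map sends the Lie bracket of two vector fields to the Lie bracket of two
vector fields related to them by this map. -/
theorem mfderiv_mlieBracket_of_related [I.Boundaryless] [I'.Boundaryless]
    [IsManifold I 2 N] [IsManifold I' 2 N'] [CompleteSpace E] [CompleteSpace E']
    {n : WithTop ℕ∞} {f : N → N'} {V W : ∀ x : N, TangentSpace I x}
    {V' W' : ∀ x : N', TangentSpace I' x} {x : N}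
    (hf : ContMDiffAt I I' n f x) (hn : minSmoothness 𝕜 2 ≤ n)
    (hV : MDifferentiableAt I I.tangent (fun x => (⟨x, V x⟩ : TangentBundle I N)) x)
    (hW : MDifferentiableAt I I.tangent (fun x => (⟨x, W x⟩ : TangentBundle I N)) x)
    (hV' : MDifferentiableAt I' I'.tangent (fun x => (⟨x, V' x⟩ : TangentBundle I' N')) (f x))
    (hW' : MDifferentiableAt I' I'.tangent (fun x => (⟨x, W' x⟩ : TangentBundle I' N')) (f x))
    (hVV' : ∀ᶠ y in 𝓝 x, mfderiv I I' f y (V y) = V' (f y))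
    (hWW' : ∀ᶠ y in 𝓝 x, mfderiv I I' f y (W y) = W' (f y)) :
    mfderiv I I' f x (mlieBracket I V W x) = mlieBracket I' V' W' (f x) := by
  have : IsManifold I 1 N := IsManifold.of_le one_le_two
  have : IsManifold I' 1 N' := IsManifold.of_le one_le_two
  set φ := extChartAt I x
  set ψ := extChartAt I' (f x) with hψ
  have h2n : 2 ≤ n := le_minSmoothness.trans hn
  have hf2 : ContMDiffAt I I' 2 f x := hf.of_le h2n
  have hφx : φ.symm (φ x) = x := extChartAt_to_inv x
  have hfn : ContDiffAt 𝕜 n (ψ ∘ f ∘ φ.symm) (φ x) := by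
    have := (contMDiffAt_iff.1 hf).2
    rwa [I.range_eq_univ, contDiffWithinAt_univ] at this
  have htend : Filter.Tendsto φ.symm (𝓝 (φ x)) (𝓝 x) := by
    have := (continuousAt_extChartAt_symm (I := I) x).tendsto
    rwa [hφx] at this
  have hfd : ∀ᶠ y in 𝓝 x, MDifferentiableAt I I' f y := by
    filter_upwards [(contMDiffAt_iff_contMDiffAt_nhds (by simp)).1 hf2] with y hy
    exact hy.mdifferentiableAt two_ne_zero
  have hfs : ∀ᶠ y in 𝓝 x, f y ∈ ψ.source :=
    hf.continuousAt.eventually (extChartAt_source_mem_nhds (I := I') (f x))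
  -- Chain rule for the chart expression of `f`. It is needed near `φ x` and not only there, because
  -- relatedness will be differentiated.
  have hcomp : ∀ y ∈ φ.target, MDifferentiableAt I I' f (φ.symm y) → f (φ.symm y) ∈ ψ.source →
      ∀ u : TangentSpace I (φ.symm y),
      fderiv 𝕜 (ψ ∘ f ∘ φ.symm) y (mfderiv I 𝓘(𝕜, E) φ (φ.symm y) u) =
        mfderiv I' 𝓘(𝕜, E') ψ (f (φ.symm y)) (mfderiv I I' f (φ.symm y) u) := by
    intro y hy hfy hfy' u
    have h1 : MDifferentiableAt 𝓘(𝕜, E) I φ.symm y := by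
      have := mdifferentiableWithinAt_extChartAt_symm hy
      rwa [I.range_eq_univ, mdifferentiableWithinAt_univ] at this
    have h3 : MDifferentiableAt I' 𝓘(𝕜, E') ψ (f (φ.symm y)) := by
      rw [hψ, extChartAt_source] at hfy'
      exact mdifferentiableAt_extChartAt hfy'
    have h4 : mfderiv 𝓘(𝕜, E) 𝓘(𝕜, E') (ψ ∘ f ∘ φ.symm) y =
        (mfderiv I' 𝓘(𝕜, E') ψ (f (φ.symm y))).comp
          ((mfderiv I I' f (φ.symm y)).comp (mfderiv 𝓘(𝕜, E) I φ.symm y)) := by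
      rw [← mfderiv_comp y hfy h1]
      exact mfderiv_comp y (f := f ∘ φ.symm) h3 (hfy.comp y h1)
    rw [mfderiv_eq_fderiv] at h4
    have h5 := mfderivWithin_extChartAt_symm_comp_mfderiv_extChartAt (I := I) hy
    rw [I.range_eq_univ, mfderivWithin_univ] at h5
    have h6 := congrArg (fun L => L u) h5
    refine (congrArg (fun L => L (mfderiv I 𝓘(𝕜, E) φ (φ.symm y) u)) h4).trans ?_
    exact congrArg (fun w => mfderiv I' 𝓘(𝕜, E') ψ (f (φ.symm y)) (mfderiv I I' f (φ.symm y) w)) h6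
  have hrel : ∀ {A : ∀ x : N, TangentSpace I x} {A' : ∀ x : N', TangentSpace I' x},
      (∀ᶠ y in 𝓝 x, mfderiv I I' f y (A y) = A' (f y)) →
      ∀ᶠ y in 𝓝 (φ x), fderiv 𝕜 (ψ ∘ f ∘ φ.symm) y
        (chartField I x A y) =
        chartField I' (f x) A' ((ψ ∘ f ∘ φ.symm) y) := by
    intro A A' h
    filter_upwards [extChartAt_target_mem_nhds (I := I) x, htend.eventually h,
      htend.eventually hfd, htend.eventually hfs] with y hy h1 h2 h3
    rw [chartField_apply A hy, hcomp y hy h2 h3, h1]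
    have h4 := chartField_apply A' (ψ.map_source h3)
    -- The base points `f (φ.symm y)` and `ψ.symm (ψ (f (φ.symm y)))` are only propositionally
    -- equal, hence the generalization to `z`.
    have key : ∀ z, f (φ.symm y) = z → mfderiv I' 𝓘(𝕜, E') ψ (f (φ.symm y)) (A' (f (φ.symm y))) =
        mfderiv I' 𝓘(𝕜, E') ψ z (A' z) := by rintro _ rfl; rfl
    exact (key _ (ψ.left_inv h3).symm).trans h4.symm
  have hval : (ψ ∘ f ∘ φ.symm) (φ x) = ψ (f x) := congrArg (fun z => ψ (f z)) hφx
  -- The bound by `minSmoothness` is what makes the second derivative symmetric over a general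
  -- field.
  have main := fderiv_lieBracket_of_related (hfn.of_le h2n) (hfn.isSymmSndFDerivAt hn)
    (differentiableAt_chartField hV) (differentiableAt_chartField hW)
    (by rw [hval]; exact differentiableAt_chartField hV')
    (by rw [hval]; exact differentiableAt_chartField hW')
    (hrel hVV') (hrel hWW')
  have hcx : ∀ u : TangentSpace I x, fderiv 𝕜 (ψ ∘ f ∘ φ.symm) (φ x) (mfderiv I 𝓘(𝕜, E) φ x u) =
        mfderiv I' 𝓘(𝕜, E') ψ (f x) (mfderiv I I' f x u) := by
    have := hcomp (φ x) (mem_extChartAt_target x) (by rw [hφx]; exact hfd.self_of_nhds)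
      (by rw [hφx]; exact hfs.self_of_nhds)
    rwa [hφx] at this
  rw [hval, ← mfderiv_extChartAt_mlieBracket, ← mfderiv_extChartAt_mlieBracket, hcx] at main
  exact (isInvertible_mfderiv_extChartAt (mem_extChartAt_source (f x))).injective main

end Related

namespace TransverseCartanGeometry

variable {EP HP : Type*} [NormedAddCommGroup EP] [NormedSpace ℂ EP] [TopologicalSpace HP]
  {IP : ModelWithCorners ℂ EP HP}
  {EM EG : Type*} [NormedAddCommGroup EM] [NormedSpace ℂ EM]
  [NormedAddCommGroup EG] [NormedSpace ℂ EG]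
  {P M G : Type*} [TopologicalSpace P] [ChartedSpace HP P]
  [TopologicalSpace M] [ChartedSpace EM M]
  [TopologicalSpace G] [ChartedSpace EG G] [Group G]

namespace PrincipalBundle

/-! ### Holomorphic sections of the Atiyah bundle and their brackets -/

section Sections

variable {B : PrincipalBundle IP EM EG P M G} [IsManifold IP 1 P] {U : Set M}
  {s t : ∀ x, B.atiyah x}

theorem IsHolSection.sub (hs : B.IsHolSection U s) (ht : B.IsHolSection U t) :
    B.IsHolSection U (fun x => s x - t x) :=
  fun p hp => (hs p hp).sub_section (ht p hp)

theorem IsHolSection.congr (hs : B.IsHolSection U s) (h : ∀ x ∈ U, t x = s x) :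
    B.IsHolSection U t := by
  refine ContMDiffOn.congr hs fun p hp => ?_
  rw [field, h _ hp]
  rfl

/-- Needed because the holomorphic lifts constructed below exist only over trivializing open sets.
-/
theorem isHolSection_of_locally (h : ∀ x ∈ U, ∃ W, IsOpen W ∧ x ∈ W ∧ B.IsHolSection W s) :
    B.IsHolSection U s := by
  intro p hp
  obtain ⟨W, hW, hx, hs⟩ := h _ hp
  exact ((hs p hx).contMDiffAt ((hW.preimage B.contMDiff_proj.continuous).mem_nhds
    hx)).contMDiffWithinAt

theorem IsHolSection.mdifferentiableAt (hs : B.IsHolSection U s) (hU : IsOpen U) {p : P}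
    (hp : B.proj p ∈ U) :
    MDifferentiableAt IP IP.tangent (fun p => (⟨p, B.field s p⟩ : TangentBundle IP P)) p :=
  (hs.contMDiffAt ((hU.preimage B.contMDiff_proj.continuous).mem_nhds hp)).mdifferentiableAt
    (by simp)

end Sections

section Bracket

variable {B : PrincipalBundle IP EM EG P M G} [IsManifold IP ω P] [LieGroup 𝓘(ℂ, EG) ω G]
  [FiniteDimensional ℂ EP] {U : Set M} {s t s' t' : ∀ x, B.atiyah x}

/-- A bracket depends only on germs, so a curvature can be computed over a trivializing
neighbourhood with other expressions for the sections. -/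
theorem bracket_congr {V : Set M} (hU : IsOpen U) (hs : B.IsHolSection U s)
    (ht : B.IsHolSection U t) {x : M} (hx : x ∈ U) (hV : IsOpen V) (hs' : B.IsHolSection V s')
    (ht' : B.IsHolSection V t') (hxV : x ∈ V)
    (hss' : ∀ y ∈ V, s y = s' y) (htt' : ∀ y ∈ V, t y = t' y) :
    B.bracket hU hs ht hx = B.bracket hV hs' ht' hxV := by
  refine Subtype.ext (funext fun p => ?_)
  have hp : B.proj p.1 ∈ V := by rw [p.2]; exact hxV
  have key : ∀ {r r' : ∀ x, B.atiyah x}, (∀ y ∈ V, r y = r' y) →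
      B.field r =ᶠ[𝓝 p.1] B.field r' := by
    intro r r' h
    filter_upwards [(hV.preimage B.contMDiff_proj.continuous).mem_nhds hp] with q hq
    rw [field, h _ hq, field]
  exact (key hss').mlieBracket_vectorField_eq (key htt')

theorem bracket_sub_right (hU : IsOpen U) (hs : B.IsHolSection U s)
    (ht : B.IsHolSection U t) (ht' : B.IsHolSection U t') {x : M} (hx : x ∈ U) :
    B.bracket hU hs (ht.sub ht') hx = B.bracket hU hs ht hx - B.bracket hU hs ht' hx := by
  have : CompleteSpace EP := FiniteDimensional.complete ℂ EP
  have : IsManifold IP 2 P := IsManifold.of_le (n := ω) le_top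
  refine Subtype.ext (funext fun p => ?_)
  have hp : B.proj p.1 ∈ U := by rw [p.2]; exact hx
  have h := mlieBracket_add_right (V := B.field s)
    ((ht.sub ht').mdifferentiableAt hU hp) (ht'.mdifferentiableAt hU hp)
  -- Additivity is applied to the decomposition `t = (t - t') + t'`.
  have h' : B.field (fun x => t x - t' x) + B.field t' = B.field t :=
    funext fun q => sub_add_cancel (B.field t q) (B.field t' q)
  rw [h'] at h
  exact eq_sub_of_add_eq h.symm

end Bracket

/-! ### Local holomorphic lifts of vector fields to the bundle -/

section Lift

variable (B : PrincipalBundle IP EM EG P M G)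

open Classical in
/-- The lift to `P` of a vector field on `M` that is horizontal in the trivialization near `x₀`
(and zero outside its domain). -/
noncomputable def trivLift (x₀ : M) (X : ∀ x : M, TangentSpace 𝓘(ℂ, EM) x) (p : P) :
    TangentSpace IP p :=
  if h : B.proj p ∈ B.baseSet x₀ then
    tcast IP ((B.triv x₀).left_inv ((B.mem_triv_source x₀).2 h))
      (mfderiv (𝓘(ℂ, EM).prod 𝓘(ℂ, EG)) IP (B.triv x₀).symm (B.triv x₀ p)
        ((X (B.triv x₀ p).1, 0) : TangentSpace 𝓘(ℂ, EM) (B.triv x₀ p).1 ×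
          TangentSpace 𝓘(ℂ, EG) (B.triv x₀ p).2))
  else 0

/-- Parametrizing points by the trivialization removes the transport of base points; the properties
below are proved in this form. -/
theorem trivLift_symm (x₀ : M) (X : ∀ x : M, TangentSpace 𝓘(ℂ, EM) x) {z : M × G}
    (hz : z.1 ∈ B.baseSet x₀) :
    B.trivLift x₀ X ((B.triv x₀).symm z) =
      mfderiv (𝓘(ℂ, EM).prod 𝓘(ℂ, EG)) IP (B.triv x₀).symm z
        ((X z.1, 0) : TangentSpace 𝓘(ℂ, EM) z.1 × TangentSpace 𝓘(ℂ, EG) z.2) := by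
  have hz' : z ∈ (B.triv x₀).target := (B.mem_triv_target x₀).2 hz
  have hp : B.proj ((B.triv x₀).symm z) ∈ B.baseSet x₀ := by rwa [B.proj_triv_symm x₀ hz]
  rw [trivLift, dif_pos hp]
  have key : ∀ (w : M × G) (h : (B.triv x₀).symm w = (B.triv x₀).symm z), w = z →
      tcast IP h (mfderiv (𝓘(ℂ, EM).prod 𝓘(ℂ, EG)) IP (B.triv x₀).symm w
        ((X w.1, 0) : TangentSpace 𝓘(ℂ, EM) w.1 × TangentSpace 𝓘(ℂ, EG) w.2)) =
      mfderiv (𝓘(ℂ, EM).prod 𝓘(ℂ, EG)) IP (B.triv x₀).symm z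
        ((X z.1, 0) : TangentSpace 𝓘(ℂ, EM) z.1 × TangentSpace 𝓘(ℂ, EG) z.2) := by
    rintro w h rfl; rfl
  exact key _ _ ((B.triv x₀).right_inv hz')

theorem mdifferentiableAt_triv_symm (x₀ : M) {z : M × G} (hz : z.1 ∈ B.baseSet x₀) :
    MDifferentiableAt (𝓘(ℂ, EM).prod 𝓘(ℂ, EG)) IP (B.triv x₀).symm z :=
  ((B.triv_spec x₀).contMDiffOn_symm.contMDiffAt
    ((B.triv x₀).open_target.mem_nhds ((B.mem_triv_target x₀).2 hz))).mdifferentiableAt (by simp)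

/-- In the trivialization, `g` acts by `(y, a) ↦ (y, a * g)`, whose derivative carries `(X, 0)` to
`(X, 0)`. Differentiating the equivariance of the inverse trivialization gives the invariance. -/
theorem trivLift_act [LieGroup 𝓘(ℂ, EG) ω G] (x₀ : M) (X : ∀ x : M, TangentSpace 𝓘(ℂ, EM) x)
    (p : P) (g : G) :
    B.trivLift x₀ X (B.act p g) =
      mfderiv IP IP (fun p' : P => B.act p' g) p (B.trivLift x₀ X p) := by
  by_cases hp : B.proj p ∈ B.baseSet x₀
  · obtain ⟨z, hz, rfl⟩ : ∃ z : M × G, z.1 ∈ B.baseSet x₀ ∧ (B.triv x₀).symm z = p :=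
      ⟨B.triv x₀ p, by rwa [B.triv_eta x₀ hp],
        (B.triv x₀).left_inv ((B.mem_triv_source x₀).2 hp)⟩
    rw [B.trivLift_symm x₀ X hz]
    have hR : HasMFDerivAt (𝓘(ℂ, EM).prod 𝓘(ℂ, EG)) (𝓘(ℂ, EM).prod 𝓘(ℂ, EG))
        (fun w : M × G => (w.1, w.2 * g)) z
        ((ContinuousLinearMap.id ℂ (TangentSpace 𝓘(ℂ, EM) z.1)).prodMap
          (mfderiv 𝓘(ℂ, EG) 𝓘(ℂ, EG) (fun a : G => a * g) z.2)) := by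
      have h := HasMFDerivAt.prodMap (p := z) (hasMFDerivAt_id (I := 𝓘(ℂ, EM)) z.1)
        ((contMDiff_mul_right (I := 𝓘(ℂ, EG)) (n := ω) (a := g)).mdifferentiableAt
          (by simp)).hasMFDerivAt
      rw [mfderiv_id] at h
      exact h
    have h1 := (B.mdifferentiableAt_triv_symm x₀ (z := (z.1, z.2 * g)) hz).hasMFDerivAt.comp z hR
    have h2 := ((B.contMDiff_act_right g).mdifferentiableAt (by simp)
      (x := (B.triv x₀).symm z)).hasMFDerivAt.comp z
        (B.mdifferentiableAt_triv_symm x₀ hz).hasMFDerivAt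
    have h3 : (fun p' : P => B.act p' g) ∘ (B.triv x₀).symm =ᶠ[𝓝 z]
        (B.triv x₀).symm ∘ (fun w : M × G => (w.1, w.2 * g)) := by
      filter_upwards [(B.triv x₀).open_target.mem_nhds ((B.mem_triv_target x₀).2 hz)] with w hw
      exact B.act_symm x₀ ((B.mem_triv_target x₀).1 hw) g
    have h4 := hasMFDerivAt_unique h2 (h1.congr_of_eventuallyEq h3)
    have h5 := congrArg (fun L => L ((X z.1, 0) : TangentSpace 𝓘(ℂ, EM) z.1 ×
      TangentSpace 𝓘(ℂ, EG) z.2)) h4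
    refine Eq.trans ?_ h5.symm
    -- The two tangent spaces sit over propositionally equal points, so the vectors are compared in
    -- the model space `EP`.
    have key : ∀ q, q = (B.triv x₀).symm (z.1, z.2 * g) → (B.trivLift x₀ X q : EP) =
        mfderiv (𝓘(ℂ, EM).prod 𝓘(ℂ, EG)) IP (B.triv x₀).symm (z.1, z.2 * g)
          ((X z.1, 0) : TangentSpace 𝓘(ℂ, EM) z.1 × TangentSpace 𝓘(ℂ, EG) (z.2 * g)) := by
      rintro _ rfl
      exact B.trivLift_symm x₀ X (z := (z.1, z.2 * g)) hz
    refine (key _ (B.act_symm x₀ hz g)).trans (congrArg (mfderiv (𝓘(ℂ, EM).prod 𝓘(ℂ, EG)) IP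
      (B.triv x₀).symm (z.1, z.2 * g)) ?_)
    exact Prod.ext rfl (map_zero (mfderiv 𝓘(ℂ, EG) 𝓘(ℂ, EG) (fun a : G => a * g) z.2)).symm
  -- The default value zero keeps the field invariant outside the domain, which is itself stable
  -- under the action.
  · rw [trivLift, dif_neg (by rwa [B.proj_act]), trivLift, dif_neg hp, map_zero]

/-- Differentiate the identity between projection composed with inverse trivialization and the first
coordinate. -/
theorem mfderiv_proj_trivLift (x₀ : M) (X : ∀ x : M, TangentSpace 𝓘(ℂ, EM) x) {p : P}
    (hp : B.proj p ∈ B.baseSet x₀) :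
    mfderiv IP 𝓘(ℂ, EM) B.proj p (B.trivLift x₀ X p) = X (B.proj p) := by
  obtain ⟨z, hz, rfl⟩ : ∃ z : M × G, z.1 ∈ B.baseSet x₀ ∧ (B.triv x₀).symm z = p :=
    ⟨B.triv x₀ p, by rwa [B.triv_eta x₀ hp],
      (B.triv x₀).left_inv ((B.mem_triv_source x₀).2 hp)⟩
  rw [B.trivLift_symm x₀ X hz]
  have h2 := (B.contMDiff_proj.mdifferentiableAt (by simp)
    (x := (B.triv x₀).symm z)).hasMFDerivAt.comp z
      (B.mdifferentiableAt_triv_symm x₀ hz).hasMFDerivAt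
  have h3 : B.proj ∘ (B.triv x₀).symm =ᶠ[𝓝 z] Prod.fst := by
    filter_upwards [(B.triv x₀).open_target.mem_nhds ((B.mem_triv_target x₀).2 hz)] with w hw
    exact B.proj_triv_symm x₀ ((B.mem_triv_target x₀).1 hw)
  have h4 := hasMFDerivAt_unique h2 ((hasMFDerivAt_fst (x := z)).congr_of_eventuallyEq h3)
  have h5 := congrArg (fun L => L ((X z.1, 0) : TangentSpace 𝓘(ℂ, EM) z.1 ×
    TangentSpace 𝓘(ℂ, EG) z.2)) h4
  have key : ∀ y, y = z.1 → (X y : EM) = X z.1 := by rintro _ rfl; rfl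
  exact h5.trans (key _ (B.proj_triv_symm x₀ hz)).symm

/-- The lift is a composite of holomorphic maps: pair `X` along the projection with the zero section
of `TG` along the group coordinate, then apply the tangent map of the inverse trivialization. -/
theorem isHolField_trivLift [IsManifold IP ω P] [IsManifold 𝓘(ℂ, EM) ω M]
    [IsManifold 𝓘(ℂ, EG) ω G] (x₀ : M) {X : ∀ x : M, TangentSpace 𝓘(ℂ, EM) x} {U : Set M}
    (hX : IsHolField 𝓘(ℂ, EM) U X) :
    IsHolField IP (B.proj ⁻¹' (U ∩ B.baseSet x₀)) (B.trivLift x₀ X) := by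
  have hzero : ContMDiff 𝓘(ℂ, EG) 𝓘(ℂ, EG).tangent ω
      (fun g : G => (⟨g, 0⟩ : TangentBundle 𝓘(ℂ, EG) G)) :=
    Bundle.contMDiff_zeroSection ℂ (TangentSpace 𝓘(ℂ, EG) : G → Type _)
  have htriv : ContMDiffOn IP (𝓘(ℂ, EM).prod 𝓘(ℂ, EG)) ω (B.triv x₀)
      (B.proj ⁻¹' (U ∩ B.baseSet x₀)) :=
    (B.triv_spec x₀).contMDiffOn.mono fun p hp => (B.mem_triv_source x₀).2 hp.2
  have h1 : ContMDiffOn IP 𝓘(ℂ, EM).tangent ω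
      (fun p => (⟨B.proj p, X (B.proj p)⟩ : TangentBundle 𝓘(ℂ, EM) M))
      (B.proj ⁻¹' (U ∩ B.baseSet x₀)) :=
    ContMDiffOn.comp (f := B.proj) hX B.contMDiff_proj.contMDiffOn fun p hp => hp.1
  have h2 : ContMDiffOn IP 𝓘(ℂ, EG).tangent ω
      (fun p => (⟨(B.triv x₀ p).2, 0⟩ : TangentBundle 𝓘(ℂ, EG) G))
      (B.proj ⁻¹' (U ∩ B.baseSet x₀)) :=
    hzero.comp_contMDiffOn (contMDiff_snd.comp_contMDiffOn htriv)
  have h3 := (contMDiff_equivTangentBundleProd_symm (I := 𝓘(ℂ, EM)) (I' := 𝓘(ℂ, EG)) (M := M)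
    (M' := G) (n := ω)).comp_contMDiffOn (h1.prodMk h2)
  have h4 := (B.triv_spec x₀).contMDiffOn_symm.contMDiffOn_tangentMapWithin (m := ω) le_top
    (B.triv x₀).open_target.uniqueMDiffOn
  have h5 := h4.comp h3 (fun p hp => (B.mem_triv_target x₀).2 hp.2)
  refine h5.congr fun p hp => ?_
  have key : ∀ (q : P) (z : M × G), z.1 ∈ B.baseSet x₀ → (B.triv x₀).symm z = q →
      (⟨q, B.trivLift x₀ X q⟩ : TangentBundle IP P) =
        tangentMapWithin (𝓘(ℂ, EM).prod 𝓘(ℂ, EG)) IP (B.triv x₀).symm (B.triv x₀).target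
          ⟨z, ((X z.1, 0) : TangentSpace 𝓘(ℂ, EM) z.1 × TangentSpace 𝓘(ℂ, EG) z.2)⟩ := by
    rintro _ z hz rfl
    rw [tangentMapWithin, mfderivWithin_of_isOpen (B.triv x₀).open_target
      ((B.mem_triv_target x₀).2 hz), B.trivLift_symm x₀ X hz]
  refine key p (B.proj p, (B.triv x₀ p).2) hp.2 ?_
  rw [← B.triv_eta x₀ hp.2, (B.triv x₀).left_inv ((B.mem_triv_source x₀).2 hp.2)]

/-- The section of the Atiyah bundle given by `trivLift`. -/
noncomputable def trivSection [LieGroup 𝓘(ℂ, EG) ω G] (x₀ : M)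
    (X : ∀ x : M, TangentSpace 𝓘(ℂ, EM) x) (x : M) : B.atiyah x :=
  ⟨fun p => B.trivLift x₀ X p.1, fun p g => B.trivLift_act x₀ X p.1 g⟩

theorem anchor_trivSection [LieGroup 𝓘(ℂ, EG) ω G] (x₀ : M)
    (X : ∀ x : M, TangentSpace 𝓘(ℂ, EM) x) {x : M} (hx : x ∈ B.baseSet x₀) :
    B.anchor x (B.trivSection x₀ X x) = X x := by
  obtain ⟨p, rfl⟩ := B.fiber_nonempty x
  rw [B.anchor_apply _ _ ⟨p, rfl⟩, tcast_rfl]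
  exact B.mfderiv_proj_trivLift x₀ X hx

theorem isHolSection_trivSection [IsManifold IP ω P] [IsManifold 𝓘(ℂ, EM) ω M]
    [LieGroup 𝓘(ℂ, EG) ω G] (x₀ : M) {X : ∀ x : M, TangentSpace 𝓘(ℂ, EM) x} {U : Set M}
    (hX : IsHolField 𝓘(ℂ, EM) U X) :
    B.IsHolSection (U ∩ B.baseSet x₀) (B.trivSection x₀ X) :=
  B.isHolField_trivLift x₀ hX

theorem anchor_surjective [LieGroup 𝓘(ℂ, EG) ω G] (x : M) :
    Function.Surjective (B.anchor x) := by
  classical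
  intro u
  -- Surjectivity is fibrewise, so `u` may be extended by zero to a discontinuous field.
  refine ⟨B.trivSection x (fun y => if h : x = y then tcast 𝓘(ℂ, EM) h u else 0) x, ?_⟩
  rw [B.anchor_trivSection x _ (B.mem_baseSet x), dif_pos rfl, tcast_rfl]

end Lift

end PrincipalBundle
end TransverseCartanGeometry

namespace TransverseCartanGeometry

variable {EP HP : Type*} [NormedAddCommGroup EP] [NormedSpace ℂ EP] [TopologicalSpace HP]
  {IP : ModelWithCorners ℂ EP HP}
  {EM EH EG : Type*} [NormedAddCommGroup EM] [NormedSpace ℂ EM]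
  [NormedAddCommGroup EH] [NormedSpace ℂ EH] [NormedAddCommGroup EG] [NormedSpace ℂ EG]
  {P M H G : Type*} [TopologicalSpace P] [ChartedSpace HP P]
  [TopologicalSpace M] [ChartedSpace EM M] [IsManifold 𝓘(ℂ, EM) ω M]
  [TopologicalSpace H] [ChartedSpace EH H] [Group H]
  [TopologicalSpace G] [ChartedSpace EG G] [Group G]

theorem PartialConnection.ext_lift {T : ∀ x : M, Submodule ℂ (TangentSpace 𝓘(ℂ, EM) x)}
    [IsManifold IP ω P] {B : PrincipalBundle IP EM EG P M G}
    {D D' : PartialConnection B T} (h : ∀ x X, D.lift x X = D'.lift x X) : D = D' := by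
  cases D
  cases D'
  congr
  exact funext fun x => LinearMap.ext (h x)

theorem Connection.form_apply [IsManifold IP ω P] {B : PrincipalBundle IP EM EG P M G}
    (D : Connection B) {x : M} (a : B.atiyah x) :
    (D.form x a : B.atiyah x) = a - D.lift x ⟨B.anchor x a, trivial⟩ := rfl

variable [LieGroup 𝓘(ℂ, EH) ω H] [LieGroup 𝓘(ℂ, EG) ω G]

/-! ### Extension of the structure group: brackets and the quotient description -/

namespace PrincipalBundle

variable (B : PrincipalBundle IP EM EH P M H) (j : ComplexLieSubgroup EH EG H G)

/-- For each fixed `g`, an invariant field on `P` and its extension are related by `p ↦ [p, g]`, and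
the images of these maps cover `P ×^H G`. -/
theorem bracket_atiyahExt [IP.Boundaryless] [IsManifold IP ω P] [FiniteDimensional ℂ EP]
    [FiniteDimensional ℂ EM] [FiniteDimensional ℂ EG] {U : Set M} (hU : IsOpen U)
    {s t : ∀ x, B.atiyah x} (hs : B.IsHolSection U s) (ht : B.IsHolSection U t) {x : M}
    (hx : x ∈ U) :
    (B.ext j).bracket hU (B.isHolSection_atiyahExt j hU hs) (B.isHolSection_atiyahExt j hU ht) hx =
      B.atiyahExt j x (B.bracket hU hs ht hx) := by
  have : CompleteSpace EP := FiniteDimensional.complete ℂ EP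
  have : CompleteSpace (EM × EG) := FiniteDimensional.complete ℂ _
  have : IsManifold IP 2 P := IsManifold.of_le (n := ω) le_top
  have : IsManifold (𝓘(ℂ, EM).prod 𝓘(ℂ, EG)) 2 (B.Ext j) := IsManifold.of_le (n := ω) le_top
  refine Subtype.ext (funext fun ⟨q, hq⟩ => ?_)
  obtain ⟨p, g, rfl⟩ := B.extMk_surj j q
  have hp : B.proj p ∈ U := by
    have : B.proj p = x := hq
    rwa [this]
  rw [B.atiyahExt_apply j _ p hq g]
  exact (mfderiv_mlieBracket_of_related (f := fun p' : P => B.extMk j p' g)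
    (B.contMDiff_extMk_right j g p) le_top
    (hs.mdifferentiableAt hU hp) (ht.mdifferentiableAt hU hp)
    ((B.isHolSection_atiyahExt j hU hs).mdifferentiableAt (p := B.extMk j p g) hU hp)
    ((B.isHolSection_atiyahExt j hU ht).mdifferentiableAt (p := B.extMk j p g) hU hp)
    (Filter.Eventually.of_forall fun p' => (B.atiyahExt_apply j (s (B.proj p')) p' rfl g).symm)
    (Filter.Eventually.of_forall fun p' => (B.atiyahExt_apply j (t (B.proj p')) p' rfl g).symm)).symm

/-- If `v` in `At(P)` has the same image in `TM` as `a`, then `a - i(v)` is vertical. -/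
theorem atiyahSum_surjective (x : M) : Function.Surjective (B.atiyahSum j x) := by
  intro a
  obtain ⟨v, hv⟩ := B.anchor_surjective x ((B.ext j).anchor x a)
  refine ⟨(⟨a - B.atiyahExt j x v, ?_⟩, v), ?_⟩
  · rw [ad, LinearMap.mem_ker, map_sub, B.anchor_atiyahExt, hv, sub_self]
  · exact sub_add_cancel _ _

/-- Projecting `w + i(v) = 0` to `TM` shows that `v` is vertical, and then `w = -i(v)`. -/
theorem ker_atiyahSum (x : M) :
    LinearMap.ker (B.atiyahSum j x) = LinearMap.range (B.adAntidiagonal j x) := by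
  ext ⟨w, v⟩
  rw [LinearMap.mem_ker, LinearMap.mem_range]
  constructor
  · intro h
    have h0 : (w : (B.ext j).atiyah x) + B.atiyahExt j x v = 0 := h
    have hv : v ∈ B.ad x := by
      have h1 := congrArg ((B.ext j).anchor x) h0
      rw [map_add, LinearMap.mem_ker.1 w.2, zero_add, B.anchor_atiyahExt, map_zero] at h1
      exact h1
    -- The sign is forced by the second component of the antidiagonal, `u ↦ -u`.
    refine ⟨-(⟨v, hv⟩ : B.ad x), Prod.ext (Subtype.ext ?_) (neg_neg v)⟩
    rw [eq_neg_of_add_eq_zero_left h0]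
    exact map_neg (B.atiyahExt j x) v
  · rintro ⟨u, hu⟩
    rw [← hu]
    change B.atiyahExt j x u + B.atiyahExt j x (-(u : B.atiyah x)) = 0
    rw [map_neg, add_neg_cancel]

end PrincipalBundle

/-- The splitting is recovered from the projection `φ` by `D(da) = a - φ(a)`, and every tangent
vector of `M` is some `da`. -/
theorem Connection.eq_of_form_eq [IsManifold IP ω P] {B : PrincipalBundle IP EM EG P M G}
    {D D' : Connection B} (h : ∀ x a, D.form x a = D'.form x a) : D = D' := by
  refine PartialConnection.ext_lift fun x ⟨X, hX⟩ => ?_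
  obtain ⟨a, rfl⟩ := B.anchor_surjective x X
  have := congrArg Subtype.val (h x a)
  rw [D.form_apply, D'.form_apply] at this
  exact sub_right_injective this

/-! ### The connection of a transverse Cartan geometry and its curvature -/

namespace TransverseCartan

variable [IsManifold IP ω P] [FiniteDimensional ℂ EP] [FiniteDimensional ℂ EM]
  [FiniteDimensional ℂ EG] {n : ℕ} {F : Foliation EM M n} {B : PrincipalBundle IP EM EH P M H}
  {j : ComplexLieSubgroup EH EG H G} (C : TransverseCartan F B j)

/-- The map `v ↦ i(v) - β([v])`, which vanishes on `ad(P)`. -/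
noncomputable def preLift (x : M) : B.atiyah x →ₗ[ℂ] (B.ext j).atiyah x :=
  B.atiyahExt j x - ((B.ext j).ad x).subtype ∘ₗ C.beta x ∘ₗ Submodule.mkQ _

theorem preLift_apply {x : M} (v : B.atiyah x) :
    C.preLift x v = B.atiyahExt j x v - C.beta x (Submodule.Quotient.mk v) := rfl

theorem anchor_preLift {x : M} (v : B.atiyah x) :
    (B.ext j).anchor x (C.preLift x v) = B.anchor x v := by
  rw [preLift_apply, map_sub, B.anchor_atiyahExt, LinearMap.mem_ker.1 (C.beta x _).2, sub_zero]

/-- The difference of the two lifts lies in `ad(P)`, where `β` agrees with `i`. Hence `i - β`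
descends to `TM`. -/
theorem preLift_eq_of_anchor_eq {x : M} {v v' : B.atiyah x} (h : B.anchor x v = B.anchor x v') :
    C.preLift x v = C.preLift x v' := by
  have hm : v - v' ∈ B.ad x := by rw [PrincipalBundle.ad, LinearMap.mem_ker, map_sub, h, sub_self]
  rw [← sub_eq_zero, ← map_sub, preLift_apply, C.beta_ad x ⟨v - v', hm⟩]
  exact sub_self _

/-- The correction term vanishes because `λX` is zero in `At(P) / λ(TF)`. -/
theorem preLift_lam {x : M} (X : F.T x) :
    C.preLift x (C.lam.lift x X) = B.atiyahExt j x (C.lam.lift x X) := by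
  have h : Submodule.Quotient.mk (p := LinearMap.range (C.lam.lift x)) (C.lam.lift x X) = 0 :=
    (Submodule.Quotient.mk_eq_zero _).2 ⟨X, rfl⟩
  rw [preLift_apply, h, map_zero]
  exact sub_zero _

theorem isHolSection_preLift {U : Set M} (hU : IsOpen U) {s : ∀ x, B.atiyah x}
    (hs : B.IsHolSection U s) : (B.ext j).IsHolSection U (fun x => C.preLift x (s x)) :=
  (B.isHolSection_atiyahExt j hU hs).sub (C.beta_holomorphic U hU s hs)

/-- Compose with any fibrewise linear section of `At(P) → TM`. The result does not depend on it, so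
the section need not vary holomorphically. -/
theorem exists_lift : ∃ L : ∀ x, TangentSpace 𝓘(ℂ, EM) x →ₗ[ℂ] (B.ext j).atiyah x,
    ∀ x v, L x (B.anchor x v) = C.preLift x v := by
  choose S hS using fun x => (B.anchor x).exists_rightInverse_of_surjective
    (LinearMap.range_eq_top.2 (B.anchor_surjective x))
  exact ⟨fun x => C.preLift x ∘ₗ S x, fun x v =>
    C.preLift_eq_of_anchor_eq (congrArg (fun f => f (B.anchor x v)) (hS x))⟩

/-- The connection on `P ×^H G` defined by a transverse Cartan geometry: it sends the image in `TM`
of `v` in the Atiyah bundle of `P` to `i(v) - β([v])`. -/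
noncomputable def connection : Connection (B.ext j) where
  lift x := C.exists_lift.choose x ∘ₗ Submodule.subtype ⊤
  anchor_lift x X := by
    obtain ⟨v, hv⟩ := B.anchor_surjective x X
    rw [LinearMap.comp_apply, Submodule.subtype_apply, ← hv, C.exists_lift.choose_spec,
      C.anchor_preLift]
  holomorphic U hU X hX := by
    refine PrincipalBundle.isHolSection_of_locally fun x hx => ?_
    have hW : IsOpen (U ∩ B.baseSet x) := hU.inter (B.triv_spec x).isOpen
    refine ⟨U ∩ B.baseSet x, hW, ⟨hx, B.mem_baseSet x⟩, ?_⟩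
    -- By independence of the lift, the values can be computed with the holomorphic lift given by
    -- the trivialization near `x`.
    refine (C.isHolSection_preLift hW (B.isHolSection_trivSection x hX)).congr fun y hy => ?_
    rw [LinearMap.comp_apply, Submodule.subtype_apply,
      ← B.anchor_trivSection x (fun y => (X y : TangentSpace 𝓘(ℂ, EM) y)) hy.2,
      C.exists_lift.choose_spec]

/-- The freedom in `v` is the point: below, `v` is `λX` along the foliation and a local holomorphic
lift for a general field. -/
theorem connection_lift_anchor {x : M} (v : B.atiyah x) {X : TangentSpace 𝓘(ℂ, EM) x}
    (h : B.anchor x v = X) : C.connection.lift x ⟨X, trivial⟩ = C.preLift x v := by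
  subst h
  exact C.exists_lift.choose_spec x v

/-- Since `w` is vertical, `v` is a lift of the image of `w + i(v)` in `TM`, so the projection
subtracts `i(v) - β([v])`. -/
theorem form_connection (x : M) (w : (B.ext j).ad x) (v : B.atiyah x) :
    C.connection.form x (B.atiyahSum j x (w, v)) = w + C.beta x (Submodule.Quotient.mk v) := by
  refine Subtype.ext ?_
  have ha : B.anchor x v = (B.ext j).anchor x (B.atiyahSum j x (w, v)) := by
    change _ = (B.ext j).anchor x (w + B.atiyahExt j x v)
    rw [map_add, LinearMap.mem_ker.1 w.2, zero_add, B.anchor_atiyahExt]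
  rw [Connection.form_apply, C.connection_lift_anchor v ha, preLift_apply]
  change (w : (B.ext j).atiyah x) + B.atiyahExt j x v - _ = w + (C.beta x _ : (B.ext j).atiyah x)
  abel

theorem connection_restrict : C.connection.restrict F.T = C.lam.induce j := by
  refine PartialConnection.ext_lift fun x X => ?_
  exact (C.connection_lift_anchor (C.lam.lift x X) (C.lam.anchor_lift x X)).trans (C.preLift_lam X)

/-- Flatness writes `[λX, λY]` as `λZ` at the point, and `i` respects brackets, so `[i(λX), i(λY)] =
i(λZ)`. -/
theorem isFlat_induce [IP.Boundaryless] : (C.lam.induce j).IsFlat := by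
  intro U hU X Y hX hY x hx
  obtain ⟨Z, hZ⟩ := C.flat U hU X Y hX hY x hx
  refine ⟨Z, ?_⟩
  refine Eq.trans ?_ (B.bracket_atiyahExt j hU (C.lam.holomorphic U hU X hX)
    (C.lam.holomorphic U hU Y hY) hx).symm
  rw [← hZ]
  rfl

theorem curvatureVanishesAlong_connection [IP.Boundaryless] :
    C.connection.CurvatureVanishesAlong F.T := by
  intro U hU X Y hX hY x hx
  set V := U ∩ B.baseSet x
  have hV : IsOpen V := hU.inter (B.triv_spec x).isOpen
  have hxV : x ∈ V := ⟨hx, B.mem_baseSet x⟩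
  have hXV := hX.mono (inter_subset_left : V ⊆ U)
  set s : ∀ x, B.atiyah x := B.trivSection x (fun y => (Y y : TangentSpace 𝓘(ℂ, EM) y))
  have hs : B.IsHolSection V s := B.isHolSection_trivSection x hY
  have hlam := C.lam.holomorphic V hV X hXV
  have hβ := C.beta_holomorphic V hV s hs
  -- Near `x`, replace `DX` by `i(λX)` and `DY` by `i(s) - β([s])`, with `s` a holomorphic lift of
  -- `Y`.
  have h1 := PrincipalBundle.bracket_congr hU
    ((C.connection.restrict F.T).holomorphic U hU X hX) (C.connection.holomorphic U hU Y hY) hx hV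
    (B.isHolSection_atiyahExt j hV hlam) ((B.isHolSection_atiyahExt j hV hs).sub hβ) hxV
    (fun y _ => (C.connection_lift_anchor (C.lam.lift y (X y)) (C.lam.anchor_lift y (X y))).trans
      (C.preLift_lam (X y)))
    (fun y hy => C.connection_lift_anchor (s y) (B.anchor_trivSection x _ hy.2))
  rw [h1, PrincipalBundle.bracket_sub_right _ _ (B.isHolSection_atiyahExt j hV hs),
    B.bracket_atiyahExt j hV hlam hs hxV]
  have h2 := C.beta_parallel V hV X hXV s hs x hxV
  -- The preimage under `D` is the image in `TM` of `[λX, s]`; evaluated with this bracket as lift,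
  -- `D` yields the two terms that `beta_parallel` identifies with the bracket.
  refine ⟨⟨B.anchor x (B.bracket hV hlam hs hxV), trivial⟩, ?_⟩
  rw [C.connection_lift_anchor _ rfl, preLift_apply, h2]
  rfl

end TransverseCartan

end TransverseCartanGeometry

/-- A transverse generalized holomorphic Cartan geometry `((E_H, λ), β)` on a foliated manifold
defines a holomorphic connection on `E_G = E_H ×^H G` which is flat along the foliation: with
`At(E_G) = (ad(E_G) ⊕ At(E_H)) / ad(E_H)`, it is the only one whose projection
`At(E_G) → ad(E_G)` is `(w, v) ↦ w + β(v)`. -/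
theorem mainTheorem10
    {EM EH EG EP : Type*}
    [NormedAddCommGroup EM] [NormedSpace ℂ EM] [FiniteDimensional ℂ EM]
    [NormedAddCommGroup EH] [NormedSpace ℂ EH] [FiniteDimensional ℂ EH]
    [NormedAddCommGroup EG] [NormedSpace ℂ EG] [FiniteDimensional ℂ EG]
    [NormedAddCommGroup EP] [NormedSpace ℂ EP] [FiniteDimensional ℂ EP]
    {M H G P : Type*}
    [TopologicalSpace M] [ChartedSpace EM M] [IsManifold 𝓘(ℂ, EM) ω M]
    [TopologicalSpace G] [ChartedSpace EG G] [Group G] [LieGroup 𝓘(ℂ, EG) ω G] [ConnectedSpace G]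
    [TopologicalSpace H] [ChartedSpace EH H] [Group H] [LieGroup 𝓘(ℂ, EH) ω H]
    [TopologicalSpace P] [ChartedSpace EP P] [IsManifold 𝓘(ℂ, EP) ω P]
    {n : ℕ} (F : Foliation EM M n)
    (j : ComplexLieSubgroup EH EG H G)
    (B : PrincipalBundle 𝓘(ℂ, EP) EM EH P M H)
    (C : TransverseCartan F B j) :
    (∀ x : M, Function.Surjective (B.atiyahSum j x) ∧
      LinearMap.ker (B.atiyahSum j x) = LinearMap.range (B.adAntidiagonal j x)) ∧
    ∃ D : Connection (B.ext j),
      (∀ (x : M) (w : (B.ext j).ad x) (v : B.atiyah x),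
        D.form x (B.atiyahSum j x (w, v)) = w + C.beta x (Submodule.Quotient.mk v)) ∧
      (D.restrict F.T).IsFlat ∧
      D.CurvatureVanishesAlong F.T ∧
      ∀ D' : Connection (B.ext j),
        (∀ (x : M) (w : (B.ext j).ad x) (v : B.atiyah x),
          D'.form x (B.atiyahSum j x (w, v)) = w + C.beta x (Submodule.Quotient.mk v)) →
        D' = D := by
  exact ⟨fun x => ⟨B.atiyahSum_surjective j x, B.ker_atiyahSum j x⟩, C.connection,
    C.form_connection, by rw [C.connection_restrict]; exact C.isFlat_induce,
    C.curvatureVanishesAlong_connection, fun D' h => Connection.eq_of_form_eq fun x a => by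
      obtain ⟨⟨w, v⟩, rfl⟩ := B.atiyahSum_surjective j x a
      rw [h, C.form_connection]⟩
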